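/- **Definitions.** Let $F$ be Thompson's group of piecewise linear orientation-preserving homeomorphisms of $[0,1]$ with dyadic breakpoints and slopes powers of $2$. Every $g\in F$ has a unique reduced pair of planar rooted binary trees $(s,t)$ with equally many leaves (no caret at the same pair of leaves in both trees) such that $g$ maps the $i$-th interval of the standard dyadic partition of $s$ affinely onto the $i$-th interval of that of $t$. Let $\operatorname{height}(g)$ be the larger of the heights of $s$ and $t$, the height of a tree being the maximal distance from a leaf to the root. A *strand diagram* is a plane graph in $[0,1]^2$ (up to isotopy), with edges of non-zero slope, whose endpoints lie on the top and bottom edges and whose interior vertices are splits (one edge above, two below) or merges (two above, one below). An *orientation* is a choice of signs for the complementary regions except the rightmost one such that, at each vertex, the region to the left of the vertex and the region between its two branches have opposite signs. It induces a sequence of signs on the top and on the bottom. A diagram is reduced if it admits neither of the two moves: (I) a split directly above a merge, sharing both edges, is replaced by one strand; (II) a merge directly above a split, sharing one edge, is replaced by two parallel strands. The oriented diagram obtained by stacking and reducing is denoted by $*$, with the right factor on top, and $D^*$ is the vertical reflection of $D$. The reduced tree pair $(s,t)$ of $g$ gives the $(1,1)$-strand diagram $\Theta_0(g)$: $s$ on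 top of the vertical reflection of $t$. The *oriented Thompson group* $\vec F\le F$ consists of those $g$ for which $\Theta_0(g)$ has an orientation with $+$ in the leftmost region (equivalently, the checkerboard surface of the link of $g$ is orientable); $\vec\Theta_0(g)$ is $\Theta_0(g)$ with this orientation. Let $S_k$ be the symmetric binary tree with $2^k$ leaves, with $+$ in the leftmost region, and $\vec\Theta_k(g)=S_k*\vec\Theta_0(g)*S_k^*$. For an oriented strand diagram $\Gamma$, the oriented tangle $\vec T(\Gamma)$ is obtained as follows. In each complementary region other than the leftmost and the rightmost, add an edge from its top (the split there, or a point of the top edge of the square) to its bottom (the merge there, or a point of the bottom edge). Replace each of the resulting $4$-valent vertices by a crossing of two strands: one joins the two branches of the split or merge, the other joins the added edge between the branches to the remaining edge; which strand is in front is a fixed convention, the same at all splits and merges. Add a trivial strand at the far left. In each region the part to the right of the added edge (in the leftmost region, of the trivial strand) keeps the sign; a $+$ part orients its left boundary downwards and its right boundary upwards, a $-$ part the other way round. Oriented tangles are isotopic, written $\cong$, if they are related by an orientation-preserving ambient isotopy that fixes the boundary. **Theorem.** Let $g,h\in\vec F$ with $g\neq h$, and let $k\ge\max(\operatorname{height}(g),\operatorname{height}(h))$.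 Then $\vec T(\vec\Theta_k(g))\not\cong\vec T(\vec\Theta_k(h))$. This holds for either convention for the crossings. -/

import Mathlib

namespace OrientedThompson

/-! ### Thompson's group and binary trees -/

/-- The elements of Thompson's group `F`: orientation-preserving homeomorphisms of `[0,1]`
(that is, order automorphisms) which, for some finite subdivision of `[0,1]` with dyadic
division points, are affine with slope a power of `2` on every piece. -/
def thompsonF : Set (unitInterval ≃o unitInterval) :=
  {g | ∃ (n : ℕ) (b : Fin (n + 1) → ℝ), StrictMono b ∧ b 0 = 0 ∧ b (Fin.last n) = 1 ∧
    (∀ i, ∃ (a : ℤ) (e : ℕ), b i = (a : ℝ) / 2 ^ e) ∧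
    ∀ i : Fin n, ∃ (j : ℤ) (c : ℝ), ∀ x : unitInterval,
      (x : ℝ) ∈ Set.Icc (b i.castSucc) (b i.succ) → (g x : ℝ) = (2 : ℝ) ^ j * x + c}

/-- Planar rooted binary trees; `BinaryTree.nil` is the tree with a single leaf,
`BinaryTree.numLeaves` the number of leaves and `BinaryTree.height` the maximal distance from a
leaf to the root. -/
abbrev PTree : Type := BinaryTree Unit

/-- The standard dyadic partition of the interval `[a, a + l]` which corresponds to a tree, as the
list (from left to right) of the pairs (left end point, length) of its intervals. -/
noncomputable def leafIntervals : PTree → ℝ → ℝ → List (ℝ × ℝ)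
  | .nil, a, l => [(a, l)]
  | .node _ s t, a, l => leafIntervals s a (l / 2) ++ leafIntervals t (a + l / 2) (l / 2)

/-- The pair of trees `(s, t)` represents `g`: the trees have equally many leaves, and `g` maps the
`i`-th interval of the partition of `s` affinely onto the `i`-th interval of that of `t`. -/
def Represents (s t : PTree) (g : unitInterval ≃o unitInterval) : Prop :=
  List.Forall₂ (fun p q : ℝ × ℝ => ∀ x : unitInterval, (x : ℝ) ∈ Set.Icc p.1 (p.1 + p.2) →
    (g x : ℝ) = q.1 + (x - p.1) * (q.2 / p.2)) (leafIntervals s 0 1) (leafIntervals t 0 1)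

/-- The numbers `i` (shifted by `o`) such that the leaves number `i` and `i + 1` of the tree
are the two children of one vertex. -/
def carets : PTree → ℕ → List ℕ
  | .nil, _ => []
  | .node _ .nil .nil, o => [o]
  | .node _ s t, o => carets s o ++ carets t (o + s.numLeaves)

/-- A pair of trees (with equally many leaves) is reduced if it has no cancelling carets. -/
def IsReducedPair (s t : PTree) : Prop :=
  List.Disjoint (carets s 0) (carets t 0)

/-- The symmetric tree with `2 ^ k` leaves. -/
def symTree : ℕ → PTree
  | 0 => .nil
  | k + 1 => .node () (symTree k) (symTree k)

/-! ### Strand diagrams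

A strand diagram is presented by the list of its vertices from top to bottom (after an isotopy
the vertices lie at different heights). `split i` is a split of the strand number `i` and `merge i`
is a merge of the strands number `i` and `i + 1`; strands are numbered from the left, from `0`. -/

/-- A vertex of a strand diagram. -/
inductive Vertex
  | split (i : ℕ)
  | merge (i : ℕ)

namespace Vertex

/-- The leftmost strand at the vertex. -/
def pos : Vertex → ℕ
  | split i => i
  | merge i => i

/-- The number of strands that enter the vertex from above. -/
def inDeg : Vertex → ℕ
  | split _ => 1
  | merge _ => 2

/-- The number of strands that leave the vertex downwards. -/
def outDeg : Vertex → ℕ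
  | split _ => 2
  | merge _ => 1

/-- The same kind of vertex in another position. -/
def moveTo : Vertex → ℕ → Vertex
  | split _, j => split j
  | merge _, j => merge j

/-- Vertical reflection. -/
def star : Vertex → Vertex
  | split i => merge i
  | merge i => split i

end Vertex

/-- Vertical reflection of a strand diagram. -/
def starWord (w : List Vertex) : List Vertex := (w.map Vertex.star).reverse

/-- The strand diagram of a tree that hangs on the strand number `o`. -/
def treeWord : PTree → ℕ → List Vertex
  | .nil, _ => []
  | .node _ s t, o => Vertex.split o :: (treeWord s o ++ treeWord t (o + s.numLeaves))

/-- The `(1,1)`-strand diagram of a pair of trees: the first tree on the top, the vertical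
reflection of the second one below it. -/
def pairWord (s t : PTree) : List Vertex := treeWord s 0 ++ starWord (treeWord t 0)

/-! ### Orientations

Signs are Booleans, `true` is `+` and `false` is `-`. A horizontal line which meets a strand diagram
in `n` strands meets all regions but the rightmost one in `n` intervals (the `i`-th interval ends
on the right at the strand number `i`), so signs of the regions give an `n`-sign on this line. -/

/-- The effect of a split of the strand number `i`: the sign `s` on the left of the strand is kept,
and the new region on the right of it has the sign `-s`. -/
def splitSigns : ℕ → List Bool → Option (List Bool)
  | _, [] => none
  | 0, s :: μ => some (s :: (!s) :: μ)
  | i + 1, s :: μ => (splitSigns i μ).map (s :: ·)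

/-- The effect of a merge of the strands number `i` and `i + 1`: the region that ends
there must have the sign opposite to that of the region on the left. -/
def mergeSigns : ℕ → List Bool → Option (List Bool)
  | _, [] => none
  | 0, [_] => none
  | 0, s :: t :: μ => if t = !s then some (s :: μ) else none
  | i + 1, s :: μ => (mergeSigns i μ).map (s :: ·)

/-- The signs below a vertex in terms of the signs above it; `none` if the vertex does not exist
or if the signing rules fail at it. -/
def Vertex.signs : Vertex → List Bool → Option (List Bool)
  | .split i, μ => splitSigns i μ
  | .merge i, μ => mergeSigns i μ

/-- The signs on the bottom line in terms of those on the top line; `none` if the latter do not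
extend to an orientation of the strand diagram. -/
def transport : List Bool → List Vertex → Option (List Bool)
  | μ, [] => some μ
  | μ, v :: w => (v.signs μ).bind fun ν => transport ν w

/-- Oriented strand diagrams from `μ` to `ν`. The orientation is determined by the signs `μ`. -/
structure OSD (μ ν : List Bool) where
  word : List Vertex
  valid : transport μ word = some ν

namespace OSD

variable {μ ν : List Bool}

/-- Exchange of the heights of two consecutive vertices without a common edge, the lower
one on the left of the upper one. -/
def Exchange (D E : OSD μ ν) : Prop :=
  ∃ (u v : List Vertex) (a b : Vertex), b.pos + b.inDeg ≤ a.pos ∧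
    D.word = u ++ [a, b] ++ v ∧
    E.word = u ++ [b, a.moveTo (a.pos + b.outDeg - b.inDeg)] ++ v

/-- Isotopy of strand diagrams. -/
def Isotopic : OSD μ ν → OSD μ ν → Prop := Relation.EqvGen Exchange

/-- `E` results from (a diagram isotopic to) `D` by one move, of type I (a split directly above a
merge, sharing two edges) or of type II (a merge directly above a split, sharing an edge). -/
def Move (D E : OSD μ ν) : Prop :=
  ∃ D' : OSD μ ν, Isotopic D D' ∧ ∃ (u v : List Vertex) (i : ℕ),
    (D'.word = u ++ [Vertex.split i, Vertex.merge i] ++ v ∨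
      D'.word = u ++ [Vertex.merge i, Vertex.split i] ++ v) ∧
    E.word = u ++ v

/-- A strand diagram is reduced if no move applies to it. -/
def IsReduced (D : OSD μ ν) : Prop := ∀ E, ¬ Move D E

/-- `E` is reduced and results from `D` by a sequence of moves. -/
def ReducesTo (D E : OSD μ ν) : Prop := Relation.ReflTransGen Move D E ∧ IsReduced E

theorem Isotopic.length_eq {D E : OSD μ ν} (h : Isotopic D E) :
    D.word.length = E.word.length := by
  induction h with
  | rel D E h =>
    obtain ⟨u, v, a, b, -, h1, h2⟩ := h
    simp [h1, h2]
  | refl => rfl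
  | symm _ _ _ ih => exact ih.symm
  | trans _ _ _ _ _ ih1 ih2 => exact ih1.trans ih2

theorem Move.length_lt {D E : OSD μ ν} (h : Move D E) : E.word.length < D.word.length := by
  obtain ⟨D', h, u, v, i, h1, h2⟩ := h
  rw [h.length_eq, h2]
  rcases h1 with h1 | h1 <;> simp [h1]

theorem exists_reducesTo (D : OSD μ ν) : ∃ E, ReducesTo D E := by
  induction hn : D.word.length using Nat.strong_induction_on generalizing D with
  | _ n ih =>
    by_cases h : IsReduced D
    · exact ⟨D, Relation.ReflTransGen.refl, h⟩
    · unfold IsReduced at h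
      push Not at h
      obtain ⟨E, hE⟩ := h
      obtain ⟨E', h1, h2⟩ := ih _ (hn ▸ hE.length_lt) E rfl
      exact ⟨E', Relation.ReflTransGen.head hE h1, h2⟩

/-- The reduced form of an oriented strand diagram (it is unique up to isotopy). -/
noncomputable def reduce (D : OSD μ ν) : OSD μ ν := (exists_reducesTo D).choose

theorem reduce_spec (D : OSD μ ν) : ReducesTo D D.reduce := (exists_reducesTo D).choose_spec

end OSD

theorem transport_append (u v : List Vertex) (μ : List Bool) :
    transport μ (u ++ v) = (transport μ u).bind fun ν => transport ν v := by
  induction u generalizing μ with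
  | nil => rfl
  | cons a u ih => simp [transport, ih, Option.bind_assoc]

theorem splitSigns_iff (i : ℕ) (μ ν : List Bool) :
    splitSigns i μ = some ν ↔ mergeSigns i ν = some μ := by
  induction i generalizing μ ν with
  | zero =>
    rcases μ with _ | ⟨s, μ⟩ <;> rcases ν with _ | ⟨a, _ | ⟨b, ν⟩⟩ <;>
      simp [splitSigns, mergeSigns]
    cases a <;> cases b <;> cases s <;> simp [eq_comm]
  | succ i ih =>
    rcases μ with _ | ⟨s, μ⟩ <;> rcases ν with _ | ⟨a, ν⟩ <;> simp [splitSigns, mergeSigns]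
    grind

theorem Vertex.signs_star {v : Vertex} {μ ν : List Bool} (h : v.signs μ = some ν) :
    v.star.signs ν = some μ := by
  cases v with
  | split i => exact (splitSigns_iff i μ ν).1 h
  | merge i => exact (splitSigns_iff i ν μ).2 h

theorem transport_star {w : List Vertex} {μ ν : List Bool} (h : transport μ w = some ν) :
    transport ν (starWord w) = some μ := by
  induction w generalizing μ with
  | nil => simp_all [transport, starWord]
  | cons a w ih =>
    simp only [transport, Option.bind_eq_some_iff] at h
    obtain ⟨κ, h1, h2⟩ := h
    have := ih h2
    simp only [starWord] at this
    simp [starWord, transport_append, this, transport, Vertex.signs_star h1]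

/-- `2ν`: replace each sign `s` in `ν` by `s, -s`. -/
def double (ν : List Bool) : List Bool := ν.flatMap fun s => [s, !s]

/-- The `2 ^ k`-sign `2 ^ k +`. -/
def signPow : ℕ → List Bool
  | 0 => [true]
  | k + 1 => double (signPow k)

/-- The signs that a tree induces on the bottom line if the leftmost region has the sign `s`. -/
def treeSigns : PTree → Bool → List Bool
  | .nil, s => [s]
  | .node _ l r, s => treeSigns l s ++ treeSigns r (!s)

theorem length_treeSigns (t : PTree) (s : Bool) : (treeSigns t s).length = t.numLeaves := by
  induction t generalizing s with
  | nil => rfl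
  | node a l r ihl ihr => simp [treeSigns, ihl, ihr, BinaryTree.numLeaves]

theorem splitSigns_append (α β : List Bool) (s : Bool) :
    splitSigns α.length (α ++ s :: β) = some (α ++ s :: (!s) :: β) := by
  induction α with
  | nil => rfl
  | cons a α ih => simp [splitSigns, ih]

theorem transport_treeWord (t : PTree) (α β : List Bool) (s : Bool) :
    transport (α ++ s :: β) (treeWord t α.length) = some (α ++ treeSigns t s ++ β) := by
  induction t generalizing α β s with
  | nil => simp [treeWord, transport, treeSigns]
  | node a l r ihl ihr =>
    have h1 := ihl α ((!s) :: β) s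
    have h2 := ihr (α ++ treeSigns l s) β (!s)
    rw [List.length_append, length_treeSigns] at h2
    simp only [List.append_assoc] at h1 h2
    simp only [treeWord, transport, Vertex.signs, splitSigns_append, Option.bind_some,
      transport_append, h1, h2, treeSigns, List.append_assoc]

theorem double_treeSigns (k : ℕ) (s : Bool) :
    double (treeSigns (symTree k) s) = treeSigns (symTree (k + 1)) s := by
  induction k generalizing s with
  | zero => simp [symTree, treeSigns, double]
  | succ k ih =>
    have h (s) : double (treeSigns (symTree (k + 1)) s) =
        double (treeSigns (symTree k) s) ++ double (treeSigns (symTree k) (!s)) := by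
      simp [symTree, treeSigns, double]
    rw [h, ih, ih]
    rfl

theorem treeSigns_symTree (k : ℕ) : treeSigns (symTree k) true = signPow k := by
  induction k with
  | zero => rfl
  | succ k ih => rw [← double_treeSigns, ih, signPow]

theorem transport_symTree (k : ℕ) :
    transport [true] (treeWord (symTree k) 0) = some (signPow k) := by
  simpa [treeSigns_symTree] using transport_treeWord (symTree k) [] [] true

/-! ### The oriented Thompson group -/

/-- The pair of trees `(s, t)` is the reduced pair of trees of `g`. -/
def IsTreePairOf (g : unitInterval ≃o unitInterval) (s t : PTree) : Prop :=
  Represents s t g ∧ IsReducedPair s t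

/-- The elements of the oriented Thompson group: those `g` in `F` for which the checkerboard
surface of the link of the reduced pair of trees of `g` is orientable. This surface has one disc
for every region of the strand diagram of `g` but the rightmost one, and one half-twisted band for
every vertex, which joins the region on the left of the vertex to the region between the two
branches. So it is orientable if and only if the discs can be given signs that are
different at the two ends of each band, `+` on the leftmost one. -/
def orientedF : Set (unitInterval ≃o unitInterval) :=
  {g | g ∈ thompsonF ∧ ∃ s t : PTree, IsTreePairOf g s t ∧
    transport [true] (pairWord s t) = some [true]}

theorem exists_treePair (g : orientedF) : ∃ p : PTree × PTree,
    IsTreePairOf (g : unitInterval ≃o unitInterval) p.1 p.2 ∧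
      transport [true] (pairWord p.1 p.2) = some [true] := by
  obtain ⟨-, s, t, h⟩ := g.2
  exact ⟨(s, t), h⟩

/-- The reduced pair of trees of an element of the oriented Thompson group. -/
noncomputable def treePair (g : orientedF) : PTree × PTree := (exists_treePair g).choose

theorem treePair_spec (g : orientedF) :
    IsTreePairOf (g : unitInterval ≃o unitInterval) (treePair g).1 (treePair g).2 ∧
      transport [true] (pairWord (treePair g).1 (treePair g).2) = some [true] :=
  (exists_treePair g).choose_spec

/-- The height of `g`: the maximum of the heights of the two trees of its reduced pair. -/
noncomputable def height (g : orientedF) : ℕ :=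
  max (treePair g).1.height (treePair g).2.height

/-- The oriented `(1,1)`-strand diagram of the reduced pair of trees of `g`. -/
noncomputable def theta₀ (g : orientedF) : OSD [true] [true] where
  word := pairWord (treePair g).1 (treePair g).2
  valid := (treePair_spec g).2

/-- The oriented strand diagram of the symmetric tree with `2 ^ k` leaves. -/
def symDiagram (k : ℕ) : OSD [true] (signPow k) where
  word := treeWord (symTree k) 0
  valid := transport_symTree k

/-- Vertical reflection of an oriented strand diagram. -/
def OSD.star {μ ν : List Bool} (D : OSD μ ν) : OSD ν μ where
  word := starWord D.word
  valid := transport_star D.valid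

/-- Concatenation of oriented strand diagrams, the first one on the top. -/
def OSD.stack {μ ν ρ : List Bool} (D : OSD μ ν) (E : OSD ν ρ) : OSD μ ρ where
  word := D.word ++ E.word
  valid := by rw [transport_append, D.valid]; exact E.valid

/-- The reduced oriented strand diagram `S_k * Θ₀(g) * S_k^*`. -/
noncomputable def theta (k : ℕ) (g : orientedF) : OSD (signPow k) (signPow k) :=
  (((symDiagram k).star.stack (theta₀ g)).stack (symDiagram k)).reduce

/-! ### Oriented tangles and isotopy

Tangles lie in the slab of the points `(x, y, z)` with `0 ≤ z ≤ 1`, with end points on the planes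
`z = 1` (top) and `z = 0` (bottom). Diagrams are projections to the `(x, z)`-plane, seen
from the side of negative `y`. -/

/-- Points of the Euclidean space. -/
abbrev Point : Type := ℝ × ℝ × ℝ

/-- The segment between two points. -/
def seg (e : Point × Point) : Set Point := segment ℝ e.1 e.2

/-- A piecewise linear oriented tangle, as a list of oriented segments (from the first to the
second point). -/
abbrev PLTangle : Type := List (Point × Point)

/-- The set of points of a tangle. -/
def PLTangle.carrier (T : PLTangle) : Set Point := {x | ∃ e ∈ T, x ∈ seg e}

/-- `γ` is an embedded arc in the tangle `T` which is positively oriented: wherever it runs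
inside a segment of `T`, it runs in the direction of this segment. -/
def PLTangle.IsPositiveArc (T : PLTangle) (γ : unitInterval → Point) : Prop :=
  Continuous γ ∧ Function.Injective γ ∧ (∀ u, γ u ∈ T.carrier) ∧
    ∀ e ∈ T, ∀ u v : unitInterval, u ≤ v → (∀ r ∈ Set.Icc u v, γ r ∈ seg e) →
      ∃ a b : ℝ, 0 ≤ a ∧ a ≤ b ∧ b ≤ 1 ∧
        γ u = AffineMap.lineMap e.1 e.2 a ∧ γ v = AffineMap.lineMap e.1 e.2 b

/-- Oriented tangles are isotopic if an ambient isotopy of the slab that fixes its boundary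
carries one to the other and preserves the orientations. -/
def PLTangle.Isotopic (S T : PLTangle) : Prop :=
  ∃ φ : unitInterval → (Point ≃ₜ Point),
    Continuous (fun p : unitInterval × Point => φ p.1 p.2) ∧
    φ 0 = Homeomorph.refl Point ∧
    (∀ (u : unitInterval) (x : Point), ¬ (0 < x.2.2 ∧ x.2.2 < 1) → φ u x = x) ∧
    φ 1 '' S.carrier = T.carrier ∧
    ∀ γ : unitInterval → Point, S.IsPositiveArc γ ↔ T.IsPositiveArc (φ 1 ∘ γ)

/-! ### The tangle of an oriented strand diagram

On a horizontal line with the signs `μ` of length `n` the tangle has the `2n` points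
`x = 0, …, 2n - 1`: the point `2i + 1` is the strand number `i`, the point `2i` with `i ≥ 1` is the
edge that is added in the region between the strands `i - 1` and `i`, and the point `0` is
the trivial strand which is added on the left. The sign of the `i`-th region is moved to the part
of it between the points `2i` and `2i + 1`, and it orients the strand on the left of this part
downwards and the strand on the right of it upwards if it is `+`, the other way round if it is `-`.
So the signs at the points, with `+` for downwards, form `double μ`. -/

/-- The segment between `P` and `Q`, oriented from `P` to `Q` if and only if `s` is `+`. -/
def orient (s : Bool) (P Q : Point) : Point × Point := if s then (P, Q) else (Q, P)

/-- The part of the tangle near a split of the strand number `i`, between the heights `z` (above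
the split, with signs `μ`) and `z'`. The strand which enters from above goes on to the edge that is
added between the two branches. The two branches are joined by an arc, which crosses this
strand: the arc passes behind it if `y > 0` and in front of it if `y < 0`. -/
noncomputable def splitSegments (y z z' : ℝ) (μ : List Bool) (i : ℕ) : PLTangle :=
  ((double μ).zipIdx.map fun p =>
    orient p.1 ((p.2 : ℝ), 0, z)
      ((if p.2 ≤ 2 * i then (p.2 : ℝ) else if p.2 = 2 * i + 1 then (p.2 : ℝ) + 1
        else (p.2 : ℝ) + 2), 0, z')) ++
  [orient (μ.getD i true) (2 * (i : ℝ) + 1, 0, z') (2 * (i : ℝ) + 2, y, (z + z') / 2),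
   orient (μ.getD i true) (2 * (i : ℝ) + 2, y, (z + z') / 2) (2 * (i : ℝ) + 3, 0, z')]

/-- The part of the tangle near a merge, between the heights `z` and `z'` (below the merge, with
signs `ν`): the vertical reflection of the part near a split, with the orientation reversed. -/
noncomputable def mergeSegments (y z z' : ℝ) (ν : List Bool) (i : ℕ) : PLTangle :=
  (splitSegments y z' z ν i).map Prod.swap

/-- Straight strands between the heights `z` and `z'`. -/
noncomputable def straightSegments (z z' : ℝ) (μ : List Bool) : PLTangle :=
  (double μ).zipIdx.map fun p => orient p.1 ((p.2 : ℝ), 0, z) ((p.2 : ℝ), 0, z')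

/-- The tangle of a strand diagram with signs `μ` on the top line, below the height `z`, where every
vertex takes a layer of height `d`; there are straight strands below the last vertex. -/
noncomputable def wordSegments (y d : ℝ) : ℝ → List Bool → List Vertex → PLTangle
  | z, μ, [] => straightSegments z (z - d) μ
  | z, μ, .split i :: w =>
    splitSegments y z (z - d) μ i ++ wordSegments y d (z - d) ((splitSigns i μ).getD []) w
  | z, μ, .merge i :: w =>
    mergeSegments y z (z - d) ((mergeSigns i μ).getD []) i ++
      wordSegments y d (z - d) ((mergeSigns i μ).getD []) w

/-- The oriented tangle of an oriented strand diagram. The Boolean `front` is the convention for the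
crossings, the same one at all splits and merges: with `true` the arc that joins the two branches
passes behind the other strand, with `false` it passes in front of it. The two conventions give
tangles that are mirror images of each other. -/
noncomputable def OSD.tangle (front : Bool) {μ ν : List Bool} (D : OSD μ ν) : PLTangle :=
  wordSegments (if front then 1 else -1) (1 / ((D.word.length : ℝ) + 1)) 1 μ D.word

end OrientedThompson

/-!
The theorem holds because the tangles are already distinguished by the way in which their strands
join the end points; neither the crossings nor the orientations are needed.

*Connectivity.* Label the points of a tangle by Booleans, continuously on the tangle. Since the
pieces of the tangle in a layer are pairwise disjoint arcs, such a labeling amounts to labels of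
the points on the horizontal lines which obey a rule at every vertex: below a split the two ends of
the new arc get the same label, and the strand that passes through it keeps its label
(`Vertex.Rel`). The relation `WordRel` between the labels on the top and those on the
bottom is therefore an isotopy invariant of the tangle (`wordRel_iff_of_isotopic`).

*The action.* A strand diagram acts on pairs of a strand and an infinite binary sequence: a split
removes the first bit and uses it to choose a branch, and a merge does the inverse
(`wordPerm`). The action is not changed by exchanges and moves, so that reducing a
diagram preserves it, and on the diagram of a pair of trees of `g` it is `g` in terms of
binary expansions. So `g` is determined by the action of `theta k g` (`theta_perm_injective`).

*The shape of the reduced diagram.* A reduced word is isotopic to one with all splits above all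
merges (`exists_wordIso_splits_merges`). If `k` is at least the height of `g`, then the action of
`theta k g` carries each strand above onto a whole dyadic part of a strand below, or conversely
(`IsNice`, `isNice_conj_pairPerm`). In a reduced word with this property no strand takes part both
in a split and in a merge: otherwise a lowest caret of a merging tree would be matched with a caret
of splits, and they would cancel. So the merges can be moved above the splits
(`OSD.IsReduced.exists_wordIso_merges_splits`).

*Decoding.* If the merges are above the splits, then the arcs at the top of the tangle are those of
the merges, and the arcs at the bottom those of the splits. An arc between the points `2i + 1` and
`2i + 3` shows that the strands `i` and `i + 1` can be merged first; removing it, one recovers the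
merges, and in the same way the splits, up to isotopy (`wordIso_of_topLabeling_iff`). Hence
`WordRel` determines the action (`wordPerm_eq_of_wordRel_iff`), and so it determines `g`.
-/

namespace OrientedThompson

/-! ### Isotopy of words -/

/-- One exchange of the heights of two consecutive vertices, on unsigned words. -/
def SwapStep (w w' : List Vertex) : Prop :=
  ∃ (u v : List Vertex) (a b : Vertex), b.pos + b.inDeg ≤ a.pos ∧
    w = u ++ [a, b] ++ v ∧ w' = u ++ [b, a.moveTo (a.pos + b.outDeg - b.inDeg)] ++ v

/-- Isotopy of unsigned words. As it does not change the signs, it agrees with isotopy of oriented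
diagrams; it is used because it can be applied to parts of a word. -/
def WordIso : List Vertex → List Vertex → Prop := Relation.EqvGen SwapStep

namespace WordIso

variable {w w' w'' u v : List Vertex}

theorem refl (w : List Vertex) : WordIso w w := Relation.EqvGen.refl w

theorem symm (h : WordIso w w') : WordIso w' w := Relation.EqvGen.symm _ _ h

theorem trans (h : WordIso w w') (h' : WordIso w' w'') : WordIso w w'' :=
  Relation.EqvGen.trans _ _ _ h h'

theorem append_left (u : List Vertex) (h : WordIso w w') : WordIso (u ++ w) (u ++ w') := by
  induction h with
  | rel _ _ h =>
    obtain ⟨x, y, a, b, h1, rfl, rfl⟩ := h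
    exact Relation.EqvGen.rel _ _ ⟨u ++ x, y, a, b, h1, by simp, by simp⟩
  | refl => exact refl _
  | symm _ _ _ ih => exact ih.symm
  | trans _ _ _ _ _ ih1 ih2 => exact ih1.trans ih2

theorem append_right (v : List Vertex) (h : WordIso w w') : WordIso (w ++ v) (w' ++ v) := by
  induction h with
  | rel _ _ h =>
    obtain ⟨x, y, a, b, h1, rfl, rfl⟩ := h
    exact Relation.EqvGen.rel _ _ ⟨x, y ++ v, a, b, h1, by simp, by simp⟩
  | refl => exact refl _
  | symm _ _ _ ih => exact ih.symm
  | trans _ _ _ _ _ ih1 ih2 => exact ih1.trans ih2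

theorem append (h : WordIso w w') (h' : WordIso u v) : WordIso (w ++ u) (w' ++ v) :=
  (h.append_right u).trans (h'.append_left w')

theorem cons (a : Vertex) (h : WordIso w w') : WordIso (a :: w) (a :: w') := h.append_left [a]

theorem swap (a b : Vertex) (h : b.pos + b.inDeg ≤ a.pos) (v : List Vertex) :
    WordIso (a :: b :: v) (b :: a.moveTo (a.pos + b.outDeg - b.inDeg) :: v) :=
  Relation.EqvGen.rel _ _ ⟨[], v, a, b, h, rfl, rfl⟩

end WordIso

theorem starWord_append (u v : List Vertex) : starWord (u ++ v) = starWord v ++ starWord u := by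
  simp [starWord]

theorem Vertex.star_star (v : Vertex) : v.star.star = v := by cases v <;> rfl

theorem starWord_starWord (w : List Vertex) : starWord (starWord w) = w := by
  have : Vertex.star ∘ Vertex.star = id := funext Vertex.star_star
  simp [starWord, List.map_reverse, this]

theorem WordIso.star {w w' : List Vertex} (h : WordIso w w') :
    WordIso (starWord w) (starWord w') := by
  induction h with
  | rel _ _ h =>
    obtain ⟨x, y, a, b, h1, rfl, rfl⟩ := h
    refine WordIso.symm (Relation.EqvGen.rel _ _ ⟨starWord y, starWord x,
      (a.moveTo (a.pos + b.outDeg - b.inDeg)).star, b.star, ?_, ?_, ?_⟩)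
    · cases a <;> cases b <;>
        simp_all [Vertex.star, Vertex.moveTo, Vertex.pos, Vertex.inDeg, Vertex.outDeg] <;> omega
    · simp [starWord]
    · cases a <;> cases b <;>
        simp_all [starWord, Vertex.star, Vertex.moveTo, Vertex.pos, Vertex.inDeg, Vertex.outDeg]
      all_goals omega
  | refl => exact .refl _
  | symm _ _ _ ih => exact ih.symm
  | trans _ _ _ _ _ ih1 ih2 => exact ih1.trans ih2

/-- Exchanging two vertices without a common edge does not change the signs below them, nor whether
the signing rules hold. -/
theorem signs_swap (a b : Vertex) (h : b.pos + b.inDeg ≤ a.pos) (μ : List Bool) :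
    (a.signs μ).bind b.signs =
      (b.signs μ).bind (a.moveTo (a.pos + b.outDeg - b.inDeg)).signs := by
  have key : ∀ (p q : ℕ) (μ : List Bool),
      ((splitSigns (p + q + 1) μ).bind (splitSigns p) =
        (splitSigns p μ).bind (splitSigns (p + q + 2))) ∧
      ((mergeSigns (p + q + 1) μ).bind (splitSigns p) =
        (splitSigns p μ).bind (mergeSigns (p + q + 2))) ∧
      ((splitSigns (p + q + 2) μ).bind (mergeSigns p) =
        (mergeSigns p μ).bind (splitSigns (p + q + 1))) ∧
      ((mergeSigns (p + q + 2) μ).bind (mergeSigns p) =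
        (mergeSigns p μ).bind (mergeSigns (p + q + 1))) := by
    intro p q
    induction p with
    | zero =>
      intro μ
      rcases μ with _ | ⟨s, _ | ⟨t, μ⟩⟩
      · simp [splitSigns, mergeSigns]
      · simp [splitSigns, mergeSigns]
      · refine ⟨?_, ?_, ?_, ?_⟩
        · cases h : splitSigns q (t :: μ) <;> simp [splitSigns, h]
        · cases h : mergeSigns q (t :: μ) <;> simp [splitSigns, mergeSigns, h]
        · cases h : splitSigns q μ <;> by_cases h' : t = !s <;>
            simp [splitSigns, mergeSigns, h, h']
        · cases h : mergeSigns q μ <;> by_cases h' : t = !s <;>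
            simp [mergeSigns, h, h']
    | succ p ih =>
      intro μ
      rcases μ with _ | ⟨s, μ⟩
      · simp [splitSigns, mergeSigns]
      · obtain ⟨h1, h2, h3, h4⟩ := ih μ
        have e1 : p + 1 + q + 1 = (p + q + 1) + 1 := by omega
        have e2 : p + 1 + q + 2 = (p + q + 2) + 1 := by omega
        have l1 (o : Option (List Bool)) (p : ℕ) : (o.map (s :: ·)).bind (splitSigns (p + 1)) =
            (o.bind (splitSigns p)).map (s :: ·) := by
          cases o <;> simp [splitSigns]
        have l2 (o : Option (List Bool)) (p : ℕ) : (o.map (s :: ·)).bind (mergeSigns (p + 1)) =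
            (o.bind (mergeSigns p)).map (s :: ·) := by
          cases o <;> simp [mergeSigns]
        rw [e1, e2]
        simp only [splitSigns, mergeSigns, l1, l2]
        exact ⟨congrArg _ h1, congrArg _ h2, congrArg _ h3, congrArg _ h4⟩
  rcases a with i | i <;> rcases b with j | j <;>
    simp only [Vertex.pos, Vertex.inDeg, Vertex.outDeg, Vertex.moveTo] at h ⊢ <;>
    obtain ⟨q, rfl⟩ := Nat.exists_eq_add_of_le h
  · convert (key j q μ).1 using 2 <;> simp only [Vertex.signs] <;> congr 1 <;> omega
  · convert (key j q μ).2.2.1 using 2 <;> simp only [Vertex.signs] <;> congr 1 <;> omega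
  · convert (key j q μ).2.1 using 2 <;> simp only [Vertex.signs] <;> congr 1 <;> omega
  · convert (key j q μ).2.2.2 using 2 <;> simp only [Vertex.signs] <;> congr 1 <;> omega

theorem WordIso.transport_eq {w w' : List Vertex} (h : WordIso w w') (μ : List Bool) :
    transport μ w = transport μ w' := by
  induction h generalizing μ with
  | rel _ _ h =>
    obtain ⟨x, y, a, b, h1, rfl, rfl⟩ := h
    rw [transport_append, transport_append, transport_append, transport_append]
    congr 2
    ext1 ν
    have := signs_swap a b h1 ν
    simpa only [transport, Option.bind_fun_some] using this
  | refl => rfl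
  | symm _ _ _ ih => exact (ih μ).symm
  | trans _ _ _ _ _ ih1 ih2 => exact (ih1 μ).trans (ih2 μ)

theorem OSD.isotopic_of_wordIso {μ ν : List Bool} {w w' : List Vertex} (h : WordIso w w')
    (hw : transport μ w = some ν) :
    OSD.Isotopic (⟨w, hw⟩ : OSD μ ν) ⟨w', (h.transport_eq μ).symm.trans hw⟩ := by
  induction h with
  | rel _ _ h => exact .rel _ _ h
  | refl => exact .refl _
  | symm _ _ h ih => exact .symm _ _ (ih ((WordIso.transport_eq h μ).trans hw))
  | trans _ _ _ h1 h2 ih1 ih2 =>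
    exact .trans _ _ _ (ih1 hw) (ih2 ((WordIso.transport_eq h1 μ).symm.trans hw))

theorem OSD.Isotopic.wordIso {μ ν : List Bool} {D E : OSD μ ν} (h : OSD.Isotopic D E) :
    WordIso D.word E.word := by
  induction h with
  | rel _ _ h => exact .rel _ _ h
  | refl => exact .refl _
  | symm _ _ _ ih => exact ih.symm
  | trans _ _ _ _ _ ih1 ih2 => exact ih1.trans ih2

/-- A reduced diagram is not isotopic to a diagram with two inverse vertices in succession: a split
above a merge admits a move of type I, a merge above a split one of type II. -/
theorem OSD.IsReduced.not_wordIso {μ ν : List Bool} {D : OSD μ ν} (h : D.IsReduced)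
    (u v : List Vertex) (a : Vertex) : ¬ WordIso D.word (u ++ [a, a.star] ++ v) := by
  intro hw
  have hv := (hw.transport_eq μ).symm.trans D.valid
  have hE : transport μ (u ++ v) = some ν := by
    rw [transport_append, transport_append, Option.bind_assoc] at hv
    obtain ⟨κ, h1, h2⟩ := Option.bind_eq_some_iff.1 hv
    obtain ⟨κ', h3, h4⟩ := Option.bind_eq_some_iff.1 h2
    simp only [transport] at h3
    obtain ⟨κ'', h5, h6⟩ := Option.bind_eq_some_iff.1 h3
    obtain ⟨κ''', h7, h8⟩ := Option.bind_eq_some_iff.1 h6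
    rw [Vertex.signs_star h5] at h7
    rw [transport_append, h1, Option.bind_some]
    simp_all
  refine h ⟨u ++ v, hE⟩ ⟨⟨_, hv⟩, isotopic_of_wordIso hw D.valid, u, v, a.pos, ?_, rfl⟩
  cases a with
  | split i => exact .inl rfl
  | merge i => exact .inr rfl

/-! ### The action on infinite binary sequences -/

/-- A split of the strand number `i` acts on pairs of a strand and an infinite binary sequence:
on the strand `i` the first bit of the sequence is removed, and it decides which of the two branches
is taken. There are strands of all numbers, so that the action does not depend on the width of the
diagram; those on the right of the vertex are shifted. -/
def splitPerm (i : ℕ) : Equiv.Perm (ℕ × Stream' Bool) where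
  toFun p := if p.1 < i then p else if p.1 = i then (i + p.2.head.toNat, p.2.tail)
    else (p.1 + 1, p.2)
  invFun p := if p.1 < i then p else if p.1 = i then (i, .cons false p.2)
    else if p.1 = i + 1 then (i, .cons true p.2) else (p.1 - 1, p.2)
  left_inv := by
    rintro ⟨j, ξ⟩
    rcases lt_trichotomy j i with h | rfl | h
    · simp [h]
    · rw [← Stream'.eta ξ]
      cases h : ξ.head <;> simp
    · have h1 : ¬ j < i := by omega
      have h2 : j ≠ i := by omega
      have h3 : ¬ j + 1 < i := by omega
      have h4 : j + 1 ≠ i := by omega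
      simp [h1, h2, h3, h4]
  right_inv := by
    rintro ⟨j, ξ⟩
    by_cases h1 : j < i
    · simp [h1]
    by_cases h2 : j = i
    · simp [h2]
    by_cases h3 : j = i + 1
    · simp [h3]
    · have h4 : ¬ j - 1 < i := by omega
      have h5 : j - 1 ≠ i := by omega
      simp only [h1, h2, h3, h4, h5, if_false]
      congr 1
      omega

/-- The action of a vertex; a merge acts as the inverse of a split. -/
def Vertex.perm : Vertex → Equiv.Perm (ℕ × Stream' Bool)
  | .split i => splitPerm i
  | .merge i => (splitPerm i)⁻¹

/-- The action of a strand diagram, from the top to the bottom. -/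
def wordPerm : List Vertex → Equiv.Perm (ℕ × Stream' Bool)
  | [] => 1
  | v :: w => wordPerm w * v.perm

theorem wordPerm_append (u v : List Vertex) : wordPerm (u ++ v) = wordPerm v * wordPerm u := by
  induction u with
  | nil => simp [wordPerm]
  | cons a u ih => simp [wordPerm, ih, mul_assoc]

theorem Vertex.perm_star (v : Vertex) : v.star.perm = v.perm⁻¹ := by
  cases v <;> simp [Vertex.star, Vertex.perm]

theorem wordPerm_star (w : List Vertex) : wordPerm (starWord w) = (wordPerm w)⁻¹ := by
  induction w with
  | nil => simp [starWord, wordPerm]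
  | cons a w ih =>
    rw [← List.singleton_append, starWord_append, wordPerm_append, ih, wordPerm_append]
    simp [starWord, wordPerm, Vertex.perm_star]

theorem splitPerm_lt {i j : ℕ} (h : j < i) (ξ : Stream' Bool) :
    splitPerm i (j, ξ) = (j, ξ) := by simp [splitPerm, h]

theorem splitPerm_cons (i : ℕ) (b : Bool) (ξ : Stream' Bool) :
    splitPerm i (i, .cons b ξ) = (i + b.toNat, ξ) := by simp [splitPerm]

theorem splitPerm_gt {i j : ℕ} (h : i < j) (ξ : Stream' Bool) :
    splitPerm i (j, ξ) = (j + 1, ξ) := by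
  simp [splitPerm, show ¬ j < i by omega, show j ≠ i by omega]

/-- The relations of the infinite presentation of Thompson's group. -/
theorem splitPerm_comm {i j : ℕ} (h : j < i) :
    splitPerm j * splitPerm i = splitPerm (i + 1) * splitPerm j := by
  ext1 ⟨l, ξ⟩
  simp only [Equiv.Perm.mul_apply]
  obtain ⟨b, ξ, rfl⟩ : ∃ b η, ξ = Stream'.cons b η := ⟨_, _, (Stream'.eta ξ).symm⟩
  rcases lt_trichotomy l j with h1 | rfl | h1
  · rw [splitPerm_lt (i := i) (by omega), splitPerm_lt h1, splitPerm_lt (by omega)]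
  · rw [splitPerm_lt h, splitPerm_cons, splitPerm_lt]
    cases b <;> simp <;> omega
  · rw [splitPerm_gt h1]
    rcases lt_trichotomy l i with h2 | rfl | h2
    · rw [splitPerm_lt h2, splitPerm_gt h1, splitPerm_lt (by omega)]
    · rw [splitPerm_cons, splitPerm_cons, splitPerm_gt (by omega)]
      congr 1
      omega
    · rw [splitPerm_gt h2, splitPerm_gt (by omega), splitPerm_gt (by omega)]

theorem perm_swap (a b : Vertex) (h : b.pos + b.inDeg ≤ a.pos) :
    b.perm * a.perm = (a.moveTo (a.pos + b.outDeg - b.inDeg)).perm * b.perm := by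
  rcases a with i | i <;> rcases b with j | j <;>
    simp only [Vertex.pos, Vertex.inDeg, Vertex.outDeg, Vertex.moveTo, Vertex.perm] at h ⊢
  · rw [show i + 2 - 1 = i + 1 by omega]
    exact splitPerm_comm (by omega)
  · obtain ⟨i, rfl⟩ : ∃ l, i = l + 1 := ⟨i - 1, by omega⟩
    have := splitPerm_comm (show j < i by omega)
    rw [show i + 1 + 1 - 2 = i by omega, inv_mul_eq_iff_eq_mul, ← mul_assoc, this, mul_assoc,
      mul_inv_cancel, mul_one]
  · have := splitPerm_comm (show j < i by omega)
    rw [show i + 2 - 1 = i + 1 by omega, eq_inv_mul_iff_mul_eq, ← mul_assoc, ← this, mul_assoc,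
      mul_inv_cancel, mul_one]
  · obtain ⟨i, rfl⟩ : ∃ l, i = l + 1 := ⟨i - 1, by omega⟩
    have := splitPerm_comm (show j < i by omega)
    rw [show i + 1 + 1 - 2 = i by omega, ← mul_inv_rev, ← mul_inv_rev, this]

theorem WordIso.perm_eq {w w' : List Vertex} (h : WordIso w w') : wordPerm w = wordPerm w' := by
  induction h with
  | rel _ _ h =>
    obtain ⟨x, y, a, b, h1, rfl, rfl⟩ := h
    simp only [wordPerm_append, wordPerm, one_mul, perm_swap a b h1]
  | refl => rfl
  | symm _ _ _ ih => exact ih.symm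
  | trans _ _ _ _ _ ih1 ih2 => exact ih1.trans ih2

theorem OSD.Move.perm_eq {μ ν : List Bool} {D E : OSD μ ν} (h : OSD.Move D E) :
    wordPerm D.word = wordPerm E.word := by
  obtain ⟨D', h1, u, v, i, h2, h3⟩ := h
  rw [h1.wordIso.perm_eq, h3]
  rcases h2 with h2 | h2 <;> simp [h2, wordPerm_append, wordPerm, Vertex.perm]

theorem OSD.perm_reduce {μ ν : List Bool} (D : OSD μ ν) :
    wordPerm D.reduce.word = wordPerm D.word := by
  have h := D.reduce_spec.1
  generalize D.reduce = E at h
  induction h with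
  | refl => rfl
  | tail _ h ih => exact h.perm_eq.symm.trans ih

/-! ### Addresses -/

/-- The word of merges at the given positions. Up to vertical reflection such words are
binary forests. -/
def merges (L : List ℕ) : List Vertex := L.map .merge

/-- The address of the strand number `l` above a word of merges: the number of the strand below the
word into which it is merged, and its path from this strand upwards (`false` is left). -/
def addr : List ℕ → ℕ → ℕ × List Bool
  | [], l => (l, [])
  | j :: L, l =>
    if l < j then addr L l
    else if l = j then ((addr L j).1, (addr L j).2 ++ [false])
    else if l = j + 1 then ((addr L j).1, (addr L j).2 ++ [true])
    else addr L (l - 1)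

theorem addr_lt {j l : ℕ} (L : List ℕ) (h : l < j) : addr (j :: L) l = addr L l := by
  simp [addr, h]

theorem addr_self (j : ℕ) (L : List ℕ) :
    addr (j :: L) j = ((addr L j).1, (addr L j).2 ++ [false]) := by
  simp [addr]

theorem addr_succ (j : ℕ) (L : List ℕ) :
    addr (j :: L) (j + 1) = ((addr L j).1, (addr L j).2 ++ [true]) := by
  simp [addr]

theorem addr_gt {j l : ℕ} (L : List ℕ) (h : j < l) : addr (j :: L) (l + 1) = addr L l := by
  simp [addr, show ¬ l + 1 < j by omega, show l + 1 ≠ j by omega, show l ≠ j by omega]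

theorem mergePerm_self (i : ℕ) (ξ : Stream' Bool) :
    (Vertex.merge i).perm (i, ξ) = (i, .cons false ξ) := by
  rw [Vertex.perm, Equiv.Perm.inv_eq_iff_eq, splitPerm_cons]
  rfl

theorem mergePerm_succ (i : ℕ) (ξ : Stream' Bool) :
    (Vertex.merge i).perm (i + 1, ξ) = (i, .cons true ξ) := by
  rw [Vertex.perm, Equiv.Perm.inv_eq_iff_eq, splitPerm_cons]
  rfl

theorem mergePerm_lt {i j : ℕ} (h : j < i) (ξ : Stream' Bool) :
    (Vertex.merge i).perm (j, ξ) = (j, ξ) := by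
  rw [Vertex.perm, Equiv.Perm.inv_eq_iff_eq, splitPerm_lt h]

theorem mergePerm_gt {i j : ℕ} (h : i < j) (ξ : Stream' Bool) :
    (Vertex.merge i).perm (j + 1, ξ) = (j, ξ) := by
  rw [Vertex.perm, Equiv.Perm.inv_eq_iff_eq, splitPerm_gt h]

theorem wordPerm_merges (L : List ℕ) (l : ℕ) (ξ : Stream' Bool) :
    wordPerm (merges L) (l, ξ) = ((addr L l).1, (addr L l).2 ++ₛ ξ) := by
  induction L generalizing l ξ with
  | nil => simp [merges, wordPerm, addr]
  | cons j L ih =>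
    have h (p) : wordPerm (merges (j :: L)) p = wordPerm (merges L) ((Vertex.merge j).perm p) := rfl
    rw [h]
    rcases lt_trichotomy l j with h1 | rfl | h1
    · rw [mergePerm_lt h1, ih, addr_lt L h1]
    · rw [mergePerm_self, ih, addr_self]
      simp [Stream'.append_append_stream, Stream'.cons_append_stream]
    · obtain ⟨l, rfl⟩ : ∃ m, l = m + 1 := ⟨l - 1, by omega⟩
      rcases Nat.lt_succ_iff_lt_or_eq.1 h1 with h2 | rfl
      · rw [mergePerm_gt h2, ih, addr_gt L h2]
      · rw [mergePerm_succ, ih, addr_succ]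
        simp [Stream'.append_append_stream, Stream'.cons_append_stream]

theorem eq_of_forall_append_stream {a b : List Bool} (h : ∀ ξ : Stream' Bool, a ++ₛ ξ = b ++ₛ ξ) :
    a = b := by
  induction a generalizing b with
  | nil =>
    cases b with
    | nil => rfl
    | cons x b =>
      have := congrArg Stream'.head (h (.const !x))
      simp [Stream'.cons_append_stream] at this
  | cons y a ih =>
    cases b with
    | nil =>
      have := congrArg Stream'.head (h (.const !y))
      simp [Stream'.cons_append_stream] at this
    | cons x b =>
      have h' (ξ : Stream' Bool) : y = x ∧ a ++ₛ ξ = b ++ₛ ξ := by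
        have := h ξ
        rw [Stream'.cons_append_stream, Stream'.cons_append_stream] at this
        exact Stream'.cons_injective2 this
      rw [(h' (.const true)).1, ih fun ξ => (h' ξ).2]

theorem addr_eq {L : List ℕ} {l r : ℕ} {a : List Bool}
    (h : ∀ ξ, wordPerm (merges L) (l, ξ) = (r, a ++ₛ ξ)) : addr L l = (r, a) := by
  simp only [wordPerm_merges, Prod.mk.injEq] at h
  exact Prod.ext (h (.const true)).1 (eq_of_forall_append_stream fun ξ => (h ξ).2)

theorem addr_eq_of_wordIso {L L' : List ℕ} (h : WordIso (merges L) (merges L')) (l : ℕ) :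
    addr L l = addr L' l :=
  addr_eq fun ξ => by rw [h.perm_eq, wordPerm_merges]

theorem wordIso_merges_left {i j : ℕ} (h : i + 2 ≤ j) (L : List ℕ) :
    WordIso (merges (j :: i :: L)) (merges (i :: (j - 1) :: L)) := by
  have := WordIso.swap (.merge j) (.merge i) h (merges L)
  simp only [Vertex.pos, Vertex.moveTo, Vertex.inDeg, Vertex.outDeg] at this
  rwa [show j + 1 - 2 = j - 1 by omega] at this

theorem wordIso_merges_right {i j : ℕ} (h : j < i) (L : List ℕ) :
    WordIso (merges (j :: i :: L)) (merges ((i + 1) :: j :: L)) :=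
  (wordIso_merges_left (show j + 2 ≤ i + 1 by omega) L).symm

theorem wordIso_merges_cons (j : ℕ) {L L' : List ℕ} (h : WordIso (merges L) (merges L')) :
    WordIso (merges (j :: L)) (merges (j :: L')) := h.cons _

/-- If the strands `i` and `i + 1` are siblings, then they can be merged first. The first merge of the
word cannot involve just one of them: it would give `i` the last bit `true` or `i + 1` the last
bit `false`. -/
theorem exists_wordIso_cons_of_siblings {L : List ℕ} {i r : ℕ} {c : List Bool}
    (h0 : addr L i = (r, c ++ [false])) (h1 : addr L (i + 1) = (r, c ++ [true])) :
    ∃ L', WordIso (merges L) (merges (i :: L')) := by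
  induction L generalizing i with
  | nil => simp [addr] at h0
  | cons j L ih =>
    rcases lt_trichotomy i j with h | rfl | h
    · rcases (show i + 1 ≤ j from h).eq_or_lt with rfl | h'
      · simp [addr_self] at h1
      · rw [addr_lt _ h] at h0
        rw [addr_lt _ h'] at h1
        obtain ⟨L', hL⟩ := ih h0 h1
        exact ⟨_, (wordIso_merges_cons j hL).trans (wordIso_merges_left h' L')⟩
    · exact ⟨L, .refl _⟩
    · obtain ⟨i, rfl⟩ : ∃ m, i = m + 1 := ⟨i - 1, by omega⟩
      rcases Nat.lt_succ_iff_lt_or_eq.1 h with h' | rfl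
      · rw [addr_gt _ h'] at h0
        rw [addr_gt _ (by omega)] at h1
        obtain ⟨L', hL⟩ := ih h0 h1
        exact ⟨_, (wordIso_merges_cons j hL).trans (wordIso_merges_right h' L')⟩
      · simp [addr_succ] at h0

/-- If the strand `l` takes part in a merge of the tree with root `r`, then two leaves of this tree
can be merged first. -/
theorem exists_wordIso_cons_of_addr {L : List ℕ} {l r : ℕ} (h : (addr L l).1 = r)
    (h' : (addr L l).2 ≠ []) :
    ∃ m L', WordIso (merges L) (merges (m :: L')) ∧ (addr L m).1 = r := by
  induction L generalizing l with
  | nil => simp [addr] at h'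
  | cons j L ih =>
    by_cases hj : (addr L j).1 = r
    · exact ⟨j, L, .refl _, by rw [addr_self, hj]⟩
    · obtain ⟨l', hl⟩ : ∃ l', addr (j :: L) l = addr L l' := by
        rcases lt_trichotomy l j with h1 | rfl | h1
        · exact ⟨l, addr_lt L h1⟩
        · exact absurd (by rwa [addr_self] at h) hj
        · obtain ⟨l, rfl⟩ : ∃ m, l = m + 1 := ⟨l - 1, by omega⟩
          rcases Nat.lt_succ_iff_lt_or_eq.1 h1 with h2 | rfl
          · exact ⟨l, addr_gt L h2⟩
          · exact absurd (by rwa [addr_succ] at h) hj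
      rw [hl] at h h'
      obtain ⟨m, L', hL, hm⟩ := ih h h'
      have hne : j ≠ m := by
        rintro rfl
        exact hj hm
      have hne' : j ≠ m + 1 := by
        rintro rfl
        rw [addr_eq_of_wordIso hL, addr_succ] at hj
        rw [addr_eq_of_wordIso hL, addr_self] at hm
        exact hj hm
      rcases lt_or_gt_of_ne hne with h1 | h1
      · exact ⟨m + 1, j :: L', (wordIso_merges_cons j hL).trans (wordIso_merges_right h1 L'),
          by rw [addr_gt L h1, hm]⟩
      · exact ⟨m, (j - 1) :: L', (wordIso_merges_cons j hL).trans
          (wordIso_merges_left (by omega) L'), by rw [addr_lt L h1, hm]⟩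

/-! ### Reduced words -/

theorem starWord_merges_cons (i : ℕ) (L : List ℕ) :
    starWord (merges (i :: L)) = starWord (merges L) ++ [.split i] := by
  simp [starWord, merges, Vertex.star]

/-- Every word is isotopic to one in which the splits are above the merges, or
to one which contains two inverse vertices in succession. -/
theorem exists_wordIso_splits_merges (w : List Vertex) :
    (∃ P M : List ℕ, WordIso w (starWord (merges P) ++ merges M)) ∨
      ∃ u a v, WordIso w (u ++ [a, a.star] ++ v) := by
  have key (M : List ℕ) (i : ℕ) :
      (∃ i' M', WordIso (merges M ++ [.split i]) (.split i' :: merges M')) ∨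
        ∃ u a v, WordIso (merges M ++ [.split i]) (u ++ [a, a.star] ++ v) := by
    -- A split can be moved above the merge before it unless the two share an edge.
    induction M using List.reverseRecOn generalizing i with
    | nil => exact .inl ⟨i, [], .refl _⟩
    | append_singleton M j ih =>
      have e : merges (M ++ [j]) ++ [.split i] = merges M ++ [.merge j, .split i] := by
        simp [merges]
      have sw : j = i ∨ ∃ i' j', WordIso [.merge j, .split i] [.split i', .merge j'] := by
        rcases lt_trichotomy i j with h | h | h
        · exact .inr ⟨_, _, .swap (.merge j) (.split i) h []⟩
        · exact .inl h.symm
        · have := WordIso.swap (.split (i + 1)) (.merge j)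
            (by simp only [Vertex.pos, Vertex.inDeg]; omega) []
          simp only [Vertex.pos, Vertex.moveTo, Vertex.inDeg, Vertex.outDeg] at this
          rw [show i + 1 + 1 - 2 = i by omega] at this
          exact .inr ⟨_, _, this.symm⟩
      rw [e]
      rcases sw with rfl | ⟨i', j', h⟩
      · exact .inr ⟨merges M, .merge j, [], by simpa using .refl _⟩
      · have h' := h.append_left (merges M)
        rcases ih i' with ⟨i'', M', hM⟩ | ⟨u, a, v, hM⟩
        · refine .inl ⟨i'', M' ++ [j'], h'.trans ?_⟩
          simpa [merges] using hM.append_right [.merge j']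
        · refine .inr ⟨u, a, v ++ [.merge j'], h'.trans ?_⟩
          simpa using hM.append_right [.merge j']
  induction w using List.reverseRecOn with
  | nil => exact .inl ⟨[], [], .refl _⟩
  | append_singleton w x ih =>
    rcases ih with ⟨P, M, h⟩ | ⟨u, a, v, h⟩
    · cases x with
      | split i =>
        have h' := h.append_right [.split i]
        rw [List.append_assoc] at h'
        rcases key M i with ⟨i', M', hM⟩ | ⟨u, a, v, hM⟩
        · refine .inl ⟨i' :: P, M', ?_⟩
          rw [starWord_merges_cons]
          simpa using h'.trans (hM.append_left _)
        · exact .inr ⟨starWord (merges P) ++ u, a, v, by simpa using h'.trans (hM.append_left _)⟩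
      | merge i =>
        exact .inl ⟨P, M ++ [i], by simpa [merges] using h.append_right [.merge i]⟩
    · exact .inr ⟨u, a, v ++ [x], by simpa using h.append_right [x]⟩

/-- A split of a strand can be moved below a word of merges which do not involve the two
branches. -/
theorem exists_wordIso_split_cons {M : List ℕ} {i : ℕ} (h0 : (addr M i).2 = [])
    (h1 : (addr M (i + 1)).2 = []) :
    ∃ i' M', WordIso (.split i :: merges M) (merges M' ++ [.split i']) ∧
      (∀ l < i, (addr M' l).2 = (addr M l).2) ∧ (addr M' i).2 = [] ∧
      ∀ l > i, (addr M' l).2 = (addr M (l + 1)).2 := by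
  induction M generalizing i with
  | nil => exact ⟨i, [], .refl _, by simp [addr]⟩
  | cons j M ih =>
    have hi : j ≠ i := by
      rintro rfl
      simp [addr_self] at h0
    have hi' : j ≠ i + 1 := by
      rintro rfl
      simp [addr_self] at h1
    have hi'' : j + 1 ≠ i := by
      rintro rfl
      simp [addr_succ] at h0
    rcases lt_or_gt_of_ne hi with h | h
    · obtain ⟨i, rfl⟩ : ∃ m, i = m + 1 := ⟨i - 1, by omega⟩
      rw [addr_gt _ (by omega)] at h0
      rw [addr_gt _ (by omega)] at h1
      obtain ⟨i', M', hM, a1, a2, a3⟩ := ih h0 h1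
      have sw := WordIso.swap (.split (i + 1)) (.merge j)
        (by simp only [Vertex.pos, Vertex.inDeg]; omega) (merges M)
      simp only [Vertex.pos, Vertex.moveTo, Vertex.inDeg, Vertex.outDeg] at sw
      rw [show i + 1 + 1 - 2 = i by omega] at sw
      refine ⟨i', j :: M', sw.trans (hM.cons _), ?_, ?_, ?_⟩
      · intro l hl
        rcases lt_trichotomy l j with h2 | rfl | h2
        · rw [addr_lt _ h2, addr_lt _ h2, a1 l (by omega)]
        · rw [addr_self, addr_self, a1 l (by omega)]
        · obtain ⟨l, rfl⟩ : ∃ m, l = m + 1 := ⟨l - 1, by omega⟩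
          rcases Nat.lt_succ_iff_lt_or_eq.1 h2 with h3 | rfl
          · rw [addr_gt _ h3, addr_gt _ h3, a1 l (by omega)]
          · rw [addr_succ, addr_succ, a1 j (by omega)]
      · rw [addr_gt _ (by omega), a2]
      · intro l hl
        obtain ⟨l, rfl⟩ : ∃ m, l = m + 1 := ⟨l - 1, by omega⟩
        rw [addr_gt _ (by omega), addr_gt _ (by omega), a3 l (by omega)]
    · obtain ⟨j, rfl⟩ : ∃ m, j = m + 1 := ⟨j - 1, by omega⟩
      rw [addr_lt _ (by omega)] at h0
      rw [addr_lt _ (by omega)] at h1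
      obtain ⟨i', M', hM, a1, a2, a3⟩ := ih h0 h1
      have sw := WordIso.swap (.merge j) (.split i)
        (by simp only [Vertex.pos, Vertex.inDeg]; omega) (merges M)
      simp only [Vertex.pos, Vertex.moveTo, Vertex.inDeg, Vertex.outDeg] at sw
      rw [show j + 2 - 1 = j + 1 by omega] at sw
      refine ⟨i', j :: M', sw.symm.trans (hM.cons _), ?_, ?_, ?_⟩
      · intro l hl
        rw [addr_lt _ (by omega), addr_lt _ (by omega), a1 l hl]
      · rw [addr_lt _ (by omega), a2]
      · intro l hl
        rcases lt_trichotomy l j with h2 | rfl | h2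
        · rw [addr_lt _ h2, addr_lt _ (by omega), a3 l (by omega)]
        · rw [addr_self, addr_self, a3 l (by omega)]
        · obtain ⟨l, rfl⟩ : ∃ m, l = m + 1 := ⟨l - 1, by omega⟩
          rcases Nat.lt_succ_iff_lt_or_eq.1 h2 with h3 | rfl
          · rw [addr_gt _ h3, addr_gt _ (by omega), a3 l (by omega)]
          · rw [addr_succ, addr_succ, a3 j (by omega)]

/-- If no strand between the splits and the merges takes part both in a split and in a merge, then
the merges can be moved above the splits. -/
theorem exists_wordIso_merges_splits (P M : List ℕ)
    (h : ∀ l, (addr P l).2 = [] ∨ (addr M l).2 = []) :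
    ∃ M' P' : List ℕ,
      WordIso (starWord (merges P) ++ merges M) (merges M' ++ starWord (merges P')) := by
  induction P generalizing M with
  | nil => exact ⟨M, [], by simpa [starWord, merges] using .refl _⟩
  | cons i P ih =>
    obtain ⟨i', M', h1, h2, h3, h4⟩ := exists_wordIso_split_cons
      ((h i).resolve_left (by simp [addr_self])) ((h (i + 1)).resolve_left (by simp [addr_succ]))
    obtain ⟨M'', P', h5⟩ := ih M' fun l => by
      rcases lt_trichotomy l i with hl | rfl | hl
      · rw [h2 l hl, ← addr_lt P hl]
        exact h l
      · exact .inr h3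
      · rw [h4 l hl, ← addr_gt P hl]
        exact h (l + 1)
    refine ⟨M'', i' :: P', ?_⟩
    rw [starWord_merges_cons, starWord_merges_cons]
    simpa using (h1.append_left (starWord (merges P))).trans
      (by simpa using h5.append_right [.split i'])

/-- If the image of the strand `j` above meets the strand `r` below, then all of `j` is carried onto a
dyadic part of `r`, or a dyadic part of `j` is carried onto all of `r`. -/
def IsNice (f : Equiv.Perm (ℕ × Stream' Bool)) : Prop :=
  ∀ j ξ, (∃ b : List Bool, ∀ η, f (j, η) = ((f (j, ξ)).1, b ++ₛ η)) ∨
    ∃ b : List Bool, ∀ η, f (j, b ++ₛ η) = ((f (j, ξ)).1, η)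

/-- Let the tree with root `r` of the forest `M` be a copy of the part below the path `b` of the tree
with root `j` of the forest `P`, in the sense that the actions agree. If it is not trivial,
then `M` and `P` can start with the same merge: that of a lowest caret of this tree. -/
theorem exists_wordIso_cancel_of_addr {P M : List ℕ} {l j r : ℕ} {b : List Bool}
    (hb : ∀ η, (wordPerm (merges P))⁻¹ (j, b ++ₛ η) = (wordPerm (merges M))⁻¹ (r, η))
    (h : (addr M l).1 = r) (h' : (addr M l).2 ≠ []) :
    ∃ m P' M', WordIso (merges P) (merges (m :: P')) ∧ WordIso (merges M) (merges (m :: M')) := by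
  obtain ⟨m, M', hM, hm⟩ := exists_wordIso_cons_of_addr h h'
  -- The leaves `m` and `m + 1` of `M` are siblings, so they are siblings in `P` as well.
  have key (x : Bool) (i : ℕ) (hi : addr M i = (r, (addr M' m).2 ++ [x])) :
      addr P i = (j, (b ++ (addr M' m).2) ++ [x]) := by
    refine addr_eq fun ξ => ?_
    have := hb (((addr M' m).2 ++ [x]) ++ₛ ξ)
    rw [Equiv.Perm.inv_eq_iff_eq, ← Stream'.append_append_stream, ← List.append_assoc] at this
    rw [this]
    congr 1
    rw [Equiv.Perm.eq_inv_iff_eq, wordPerm_merges, hi]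
  have hr : (addr M' m).1 = r := by
    rw [addr_eq_of_wordIso hM, addr_self] at hm
    exact hm
  obtain ⟨P', hP⟩ := exists_wordIso_cons_of_siblings
    (key false m (by rw [addr_eq_of_wordIso hM, addr_self, hr]))
    (key true (m + 1) (by rw [addr_eq_of_wordIso hM, addr_succ, hr]))
  exact ⟨m, P', M', hP, hM⟩

/-- A reduced diagram with nice action is isotopic to one whose merges are above its splits. -/
theorem OSD.IsReduced.exists_wordIso_merges_splits {μ ν : List Bool} {D : OSD μ ν}
    (h : D.IsReduced) (hf : IsNice (wordPerm D.word)) :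
    ∃ M P : List ℕ, WordIso D.word (merges M ++ starWord (merges P)) := by
  obtain ⟨P, M, hw⟩ := (exists_wordIso_splits_merges D.word).resolve_right
    fun ⟨u, a, v, hw⟩ => h.not_wordIso u v a hw
  obtain ⟨M', P', h'⟩ := OrientedThompson.exists_wordIso_merges_splits P M fun l => by
    by_contra! hl
    have e : wordPerm D.word = wordPerm (merges M) * (wordPerm (merges P))⁻¹ := by
      rw [hw.perm_eq, wordPerm_append, wordPerm_star]
    have cancel : ¬ ∃ m P' M', WordIso (merges P) (merges (m :: P')) ∧
        WordIso (merges M) (merges (m :: M')) := by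
      rintro ⟨m, P', M', h1, h2⟩
      refine h.not_wordIso (starWord (merges P')) (merges M') (.split m) (hw.trans ?_)
      have := h1.star.append h2
      rw [starWord_merges_cons] at this
      simpa [merges, Vertex.star] using this
    -- If the strand `l` takes part both in a split and in a merge, then a split can be moved
    -- directly above a merge of the same strands.
    have hjr (ξ) : wordPerm D.word ((addr P l).1, (addr P l).2 ++ₛ ξ) =
        ((addr M l).1, (addr M l).2 ++ₛ ξ) := by
      rw [e, ← wordPerm_merges, ← wordPerm_merges]
      simp
    have := hf (addr P l).1 ((addr P l).2 ++ₛ .const true)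
    rw [hjr] at this
    rcases this with ⟨b, hb⟩ | ⟨b, hb⟩
    · obtain ⟨m, P', M', h1, h2⟩ := exists_wordIso_cancel_of_addr (P := M) (M := P) (l := l)
        (j := (addr M l).1) (r := (addr P l).1) (b := b) (fun η => by
          rw [Equiv.Perm.inv_eq_iff_eq, ← hb, e]; rfl) rfl hl.1
      exact cancel ⟨m, M', P', h2, h1⟩
    · exact cancel (exists_wordIso_cancel_of_addr (P := P) (M := M) (l := l)
        (j := (addr P l).1) (r := (addr M l).1) (b := b) (fun η => by
          rw [Equiv.Perm.eq_inv_iff_eq, ← hb, e]; rfl) rfl hl.2)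
  exact ⟨M', P', hw.trans h'⟩

/-! ### Labelings of the tangle -/

/-- The labels below a split of the strand `i`, from the labels `α` above it: the two ends
of the new arc have the same label `x`, and the strand which passes between them keeps its
label. Labels are given to all natural numbers; only the first `2 n` of them belong to points of the
tangle where there are `n` strands, and the others are shifted. -/
def insertArc (i : ℕ) (x : Bool) (α : ℕ → Bool) (k : ℕ) : Bool :=
  if k ≤ 2 * i then α k else if k = 2 * i + 2 then α (2 * i + 1)
  else if k ≤ 2 * i + 3 then x else α (k - 2)

theorem insertArc_injective {i : ℕ} {x y : Bool} {α β : ℕ → Bool}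
    (h : insertArc i x α = insertArc i y β) : x = y ∧ α = β := by
  constructor
  · have := congrFun h (2 * i + 1)
    simpa [insertArc] using this
  · funext k
    rcases lt_trichotomy k (2 * i + 1) with h1 | rfl | h1
    · have := congrFun h k
      simpa [insertArc, show k ≤ 2 * i by omega] using this
    · have := congrFun h (2 * i + 2)
      simpa [insertArc] using this
    · have := congrFun h (k + 2)
      simpa [insertArc, show ¬ k + 2 ≤ 2 * i by omega, show k ≠ 2 * i by omega,
        show ¬ k ≤ 2 * i + 1 by omega] using this

theorem insertArc_comm {i j : ℕ} (h : j < i) (x y : Bool) (α : ℕ → Bool) :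
    insertArc j y (insertArc i x α) = insertArc (i + 1) x (insertArc j y α) := by
  funext k
  simp only [insertArc]
  grind

/-- A labeling with two arcs is obtained by inserting them in either order. -/
theorem exists_of_insertArc_eq {i j : ℕ} (h : j < i) {x y : Bool} {α β : ℕ → Bool}
    (e : insertArc j y α = insertArc (i + 1) x β) :
    ∃ γ, α = insertArc i x γ ∧ β = insertArc j y γ := by
  set γ : ℕ → Bool :=
    fun k => if k ≤ 2 * j then β k else if k = 2 * j + 1 then β (2 * j + 2) else β (k + 2) with hγ
  have hβ : β = insertArc j y γ := by
    funext k
    have h1 := congrFun e (2 * j + 1)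
    have h2 := congrFun e (2 * j + 3)
    simp only [insertArc, hγ] at h1 h2 ⊢
    grind
  refine ⟨γ, ?_, hβ⟩
  rw [hβ, ← insertArc_comm h] at e
  exact (insertArc_injective e).2

/-- The labels above and below a vertex of a labeling of the tangle by Booleans
which is constant on the components. -/
def Vertex.Rel : Vertex → (ℕ → Bool) → (ℕ → Bool) → Prop
  | .split i, α, β => ∃ x, β = insertArc i x α
  | .merge i, α, β => ∃ x, α = insertArc i x β

/-- The labels on the top and on the bottom of a labeling of the tangle by Booleans
which is constant on the components. -/
def WordRel : List Vertex → (ℕ → Bool) → (ℕ → Bool) → Prop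
  | [], α, β => α = β
  | v :: w, α, β => ∃ γ, v.Rel α γ ∧ WordRel w γ β

theorem wordRel_append (u v : List Vertex) (α β : ℕ → Bool) :
    WordRel (u ++ v) α β ↔ ∃ γ, WordRel u α γ ∧ WordRel v γ β := by
  induction u generalizing α with
  | nil => simp [WordRel]
  | cons a u ih =>
    simp only [List.cons_append, WordRel, ih]
    exact ⟨fun ⟨γ, h1, δ, h2, h3⟩ => ⟨δ, ⟨γ, h1, h2⟩, h3⟩, fun ⟨δ, ⟨γ, h1, h2⟩, h3⟩ => ⟨γ, h1, δ, h2, h3⟩⟩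

theorem wordRel_singleton (a : Vertex) (α β : ℕ → Bool) : WordRel [a] α β ↔ a.Rel α β := by
  simp [WordRel]

theorem Vertex.rel_star (a : Vertex) (α β : ℕ → Bool) : a.star.Rel α β ↔ a.Rel β α := by
  cases a <;> rfl

theorem wordRel_star (w : List Vertex) (α β : ℕ → Bool) :
    WordRel (starWord w) α β ↔ WordRel w β α := by
  induction w generalizing α β with
  | nil => simp [starWord, WordRel, eq_comm]
  | cons a w ih =>
    rw [← List.singleton_append, starWord_append, wordRel_append, wordRel_append]
    refine exists_congr fun γ => ?_
    rw [ih, wordRel_singleton, and_comm, ← Vertex.rel_star, ← wordRel_singleton]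
    rfl

theorem rel_swap (a b : Vertex) (h : b.pos + b.inDeg ≤ a.pos) (α β : ℕ → Bool) :
    (∃ γ, a.Rel α γ ∧ b.Rel γ β) ↔
      ∃ γ, b.Rel α γ ∧ (a.moveTo (a.pos + b.outDeg - b.inDeg)).Rel γ β := by
  rcases a with i | i <;> rcases b with j | j <;>
    simp only [Vertex.pos, Vertex.inDeg, Vertex.outDeg, Vertex.moveTo, Vertex.Rel] at h ⊢
  · rw [show i + 2 - 1 = i + 1 by omega]
    constructor
    · rintro ⟨_, ⟨x, rfl⟩, y, rfl⟩
      exact ⟨_, ⟨y, rfl⟩, x, insertArc_comm (by omega) _ _ _⟩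
    · rintro ⟨_, ⟨x, rfl⟩, y, rfl⟩
      exact ⟨_, ⟨y, rfl⟩, x, (insertArc_comm (by omega) _ _ _).symm⟩
  · obtain ⟨i, rfl⟩ : ∃ l, i = l + 1 := ⟨i - 1, by omega⟩
    rw [show i + 1 + 1 - 2 = i by omega]
    constructor
    · rintro ⟨γ, ⟨x, rfl⟩, y, e⟩
      obtain ⟨δ, h1, h2⟩ := exists_of_insertArc_eq (by omega) e.symm
      exact ⟨δ, ⟨y, h2⟩, x, h1⟩
    · rintro ⟨γ, ⟨x, rfl⟩, y, rfl⟩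
      exact ⟨_, ⟨y, rfl⟩, x, (insertArc_comm (by omega) _ _ _).symm⟩
  · rw [show i + 2 - 1 = i + 1 by omega]
    constructor
    · rintro ⟨γ, ⟨x, rfl⟩, y, rfl⟩
      exact ⟨_, ⟨y, rfl⟩, x, insertArc_comm (by omega) _ _ _⟩
    · rintro ⟨γ, ⟨x, rfl⟩, y, e⟩
      obtain ⟨δ, h1, h2⟩ := exists_of_insertArc_eq (by omega) e
      exact ⟨δ, ⟨y, h1⟩, x, h2⟩
  · obtain ⟨i, rfl⟩ : ∃ l, i = l + 1 := ⟨i - 1, by omega⟩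
    rw [show i + 1 + 1 - 2 = i by omega]
    constructor
    · rintro ⟨γ, ⟨x, rfl⟩, y, rfl⟩
      exact ⟨_, ⟨y, (insertArc_comm (by omega) _ _ _).symm⟩, x, rfl⟩
    · rintro ⟨γ, ⟨x, rfl⟩, y, rfl⟩
      exact ⟨_, ⟨y, insertArc_comm (by omega) _ _ _⟩, x, rfl⟩

theorem WordIso.rel_iff {w w' : List Vertex} (h : WordIso w w') (α β : ℕ → Bool) :
    WordRel w α β ↔ WordRel w' α β := by
  induction h generalizing α β with
  | rel _ _ h =>
    obtain ⟨x, y, a, b, h1, rfl, rfl⟩ := h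
    simp only [wordRel_append]
    refine exists_congr fun γ => and_congr_left fun _ => exists_congr fun δ =>
      and_congr_right fun _ => ?_
    simpa [WordRel] using rel_swap a b h1 δ γ
  | refl => rfl
  | symm _ _ _ ih => exact (ih α β).symm
  | trans _ _ _ _ _ ih1 ih2 => exact (ih1 α β).trans (ih2 α β)

/-! ### Recovering the diagram from the labelings -/

/-- The labelings of the top of a word of merges which extend to the tangle. -/
def TopLabeling (M : List ℕ) (α : ℕ → Bool) : Prop := ∃ β, WordRel (merges M) α β

theorem topLabeling_nil (α : ℕ → Bool) : TopLabeling [] α := ⟨α, rfl⟩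

theorem topLabeling_cons {j : ℕ} {M : List ℕ} {α : ℕ → Bool} :
    TopLabeling (j :: M) α ↔ ∃ x γ, α = insertArc j x γ ∧ TopLabeling M γ :=
  ⟨fun ⟨β, γ, ⟨x, h⟩, h'⟩ => ⟨x, γ, h, β, h'⟩, fun ⟨x, γ, h, β, h'⟩ => ⟨β, γ, ⟨x, h⟩, h'⟩⟩

theorem topLabeling_insertArc {j : ℕ} {M : List ℕ} {x : Bool} {γ : ℕ → Bool} :
    TopLabeling (j :: M) (insertArc j x γ) ↔ TopLabeling M γ := by
  rw [topLabeling_cons]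
  refine ⟨fun ⟨y, δ, h, h'⟩ => ?_, fun h => ⟨x, γ, rfl, h⟩⟩
  rwa [(insertArc_injective h).2]

theorem topLabeling_const (M : List ℕ) (x : Bool) : TopLabeling M fun _ => x := by
  induction M with
  | nil => exact topLabeling_nil _
  | cons j M ih =>
    refine topLabeling_cons.2 ⟨x, _, ?_, ih⟩
    funext k
    simp [insertArc]

theorem WordIso.topLabeling_iff {M M' : List ℕ} (h : WordIso (merges M) (merges M'))
    (α : ℕ → Bool) : TopLabeling M α ↔ TopLabeling M' α :=
  exists_congr fun β => h.rel_iff α β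

theorem exists_wordRel_merges (P : List ℕ) (β : ℕ → Bool) : ∃ α, WordRel (merges P) α β := by
  induction P with
  | nil => exact ⟨β, rfl⟩
  | cons j P ih =>
    obtain ⟨γ, h⟩ := ih
    exact ⟨insertArc j true γ, γ, ⟨true, rfl⟩, h⟩

/-- If the labels of the points `2i + 1` and `2i + 3` always agree, then the strands `i` and `i + 1`
can be merged first. A first merge which involves just one of them would give an arc from
one of these points to another point, whose label could be changed independently. -/
theorem exists_wordIso_cons_of_topLabeling {M : List ℕ} {i : ℕ}
    (h : ∀ α, TopLabeling M α → α (2 * i + 1) = α (2 * i + 3)) :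
    ∃ M', WordIso (merges M) (merges (i :: M')) := by
  induction M generalizing i with
  | nil =>
    have := h (fun k => decide (k = 2 * i + 1)) (topLabeling_nil _)
    simp at this
  | cons j M ih =>
    rcases lt_trichotomy j i with h1 | rfl | h1
    · obtain ⟨i, rfl⟩ : ∃ m, i = m + 1 := ⟨i - 1, by omega⟩
      rcases Nat.lt_succ_iff_lt_or_eq.1 h1 with h2 | rfl
      · obtain ⟨M', hM⟩ := ih (i := i) fun α hα => by
          have := h _ (topLabeling_insertArc (x := true).2 hα)
          simp only [insertArc] at this
          grind
        exact ⟨_, (wordIso_merges_cons j hM).trans (wordIso_merges_right h2 M')⟩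
      · have := h _ (topLabeling_insertArc (x := true).2 (topLabeling_const M false))
        simp only [insertArc] at this
        grind
    · exact ⟨M, .refl _⟩
    · rcases (show i + 1 ≤ j from h1).eq_or_lt with rfl | h2
      · have := h _ (topLabeling_insertArc (x := true).2 (topLabeling_const M false))
        simp only [insertArc] at this
        grind
      · obtain ⟨M', hM⟩ := ih (i := i) fun α hα => by
          have := h _ (topLabeling_insertArc (x := true).2 hα)
          simp only [insertArc] at this
          grind
        exact ⟨_, (wordIso_merges_cons j hM).trans (wordIso_merges_left h2 M')⟩

/-- The arcs at the top determine a word of merges up to isotopy. -/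
theorem wordIso_of_topLabeling_iff {M M' : List ℕ}
    (h : ∀ α, TopLabeling M α ↔ TopLabeling M' α) : WordIso (merges M) (merges M') := by
  induction M generalizing M' with
  | nil =>
    cases M' with
    | nil => exact .refl _
    | cons j M' =>
      obtain ⟨x, γ, h1, -⟩ := topLabeling_cons.1
        ((h fun k => decide (k = 2 * j + 1)).1 (topLabeling_nil _))
      have e1 := congrFun h1 (2 * j + 1)
      have e2 := congrFun h1 (2 * j + 3)
      simp [insertArc] at e1 e2
      simp [e1] at e2
  | cons i M ih =>
    obtain ⟨M'', hM⟩ := exists_wordIso_cons_of_topLabeling (M := M') (i := i) fun α hα => by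
      obtain ⟨x, γ, rfl, -⟩ := topLabeling_cons.1 ((h α).2 hα)
      simp [insertArc]
    refine (wordIso_merges_cons i (ih fun γ => ?_)).trans hM.symm
    rw [← topLabeling_insertArc (j := i) (x := true), h, hM.topLabeling_iff, topLabeling_insertArc]

/-- If the merges are above the splits, then the labelings determine the action. -/
theorem wordPerm_eq_of_wordRel_iff {w w' : List Vertex} {M P M' P' : List ℕ}
    (hw : WordIso w (merges M ++ starWord (merges P)))
    (hw' : WordIso w' (merges M' ++ starWord (merges P')))
    (h : ∀ α β, WordRel w α β ↔ WordRel w' α β) : wordPerm w = wordPerm w' := by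
  have key (M P : List ℕ) (α : ℕ → Bool) :
      (∃ β, WordRel (merges M ++ starWord (merges P)) α β) ↔ TopLabeling M α := by
    simp only [wordRel_append, wordRel_star]
    constructor
    · rintro ⟨β, γ, h1, -⟩
      exact ⟨γ, h1⟩
    · rintro ⟨γ, h1⟩
      obtain ⟨β, h2⟩ := exists_wordRel_merges P γ
      exact ⟨β, γ, h1, h2⟩
  have hM : WordIso (merges M) (merges M') := wordIso_of_topLabeling_iff fun α => by
    rw [← key M P, ← key M' P']
    exact exists_congr fun β => by rw [← hw.rel_iff, h, hw'.rel_iff]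
  have e (M P : List ℕ) : starWord (merges M ++ starWord (merges P)) =
      merges P ++ starWord (merges M) := by
    rw [starWord_append, starWord_starWord]
  have hP : WordIso (merges P) (merges P') := wordIso_of_topLabeling_iff fun α => by
    rw [← key P M, ← key P' M']
    exact exists_congr fun β => by
      rw [← e M P, ← e M' P', wordRel_star, wordRel_star, ← hw.rel_iff, h, hw'.rel_iff]
  rw [hw.perm_eq, hw'.perm_eq, (hM.append hP.star).perm_eq]

/-! ### The action of the diagram of a pair of trees -/

/-- The paths from the root to the leaves of a tree, from left to right. -/
def leafPaths : PTree → List (List Bool)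
  | .nil => [[]]
  | .node _ s t => (leafPaths s).map (.cons false) ++ (leafPaths t).map (.cons true)

theorem length_leafPaths (t : PTree) : (leafPaths t).length = t.numLeaves := by
  induction t with
  | nil => rfl
  | node _ l r ihl ihr => simp [leafPaths, BinaryTree.numLeaves, ihl, ihr]

theorem length_le_height {t : PTree} {a : List Bool} (h : a ∈ leafPaths t) :
    a.length ≤ t.height := by
  induction t generalizing a with
  | nil => simp_all [leafPaths]
  | node _ l r ihl ihr =>
    simp only [leafPaths, List.mem_append, List.mem_map] at h
    obtain ⟨a, ha, rfl⟩ | ⟨a, ha, rfl⟩ := h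
    · have := ihl ha
      simp [BinaryTree.height, this]
    · have := ihr ha
      simp [BinaryTree.height, this]

theorem exists_leafPath (t : PTree) (ξ : Stream' Bool) : ∃ a ∈ leafPaths t, ∃ η, ξ = a ++ₛ η := by
  induction t generalizing ξ with
  | nil => exact ⟨[], by simp [leafPaths], ξ, by simp⟩
  | node _ l r ihl ihr =>
    obtain ⟨b, ξ, rfl⟩ : ∃ b η, ξ = Stream'.cons b η := ⟨_, _, (Stream'.eta ξ).symm⟩
    cases b
    · obtain ⟨a, ha, η, rfl⟩ := ihl ξ
      exact ⟨false :: a, by simp [leafPaths, ha], η, rfl⟩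
    · obtain ⟨a, ha, η, rfl⟩ := ihr ξ
      exact ⟨true :: a, by simp [leafPaths, ha], η, rfl⟩

theorem treePerm_lt (t : PTree) {o j : ℕ} (h : j < o) (ξ : Stream' Bool) :
    wordPerm (treeWord t o) (j, ξ) = (j, ξ) := by
  induction t generalizing o with
  | nil => simp [treeWord, wordPerm]
  | node _ l r ihl ihr =>
    simp [treeWord, wordPerm, wordPerm_append, Vertex.perm, splitPerm_lt h, ihl h,
      ihr (show j < o + l.numLeaves by omega)]

theorem treePerm_gt (t : PTree) {o j : ℕ} (h : o < j) (ξ : Stream' Bool) :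
    wordPerm (treeWord t o) (j, ξ) = (j + t.numLeaves - 1, ξ) := by
  induction t generalizing o j with
  | nil => simp [treeWord, wordPerm, BinaryTree.numLeaves]
  | node _ l r ihl ihr =>
    have := l.numLeaves_pos
    have := r.numLeaves_pos
    simp only [treeWord, wordPerm, wordPerm_append, Vertex.perm, Equiv.Perm.mul_apply,
      splitPerm_gt h, ihl (show o < j + 1 by omega), BinaryTree.numLeaves]
    rw [ihr (by omega)]
    congr 1
    omega

/-- The diagram of a tree removes the path of the leaf number `i` and leads to the strand of this
leaf. -/
theorem treePerm_leaf {t : PTree} {i : ℕ} {a : List Bool} (h : (leafPaths t)[i]? = some a)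
    (o : ℕ) (ξ : Stream' Bool) : wordPerm (treeWord t o) (o, a ++ₛ ξ) = (o + i, ξ) := by
  induction t generalizing o i a with
  | nil =>
    have h' := (List.getElem?_eq_some_iff.1 h).1
    obtain rfl : i = 0 := by simpa [leafPaths] using h'
    simp only [leafPaths, List.getElem?_cons_zero, Option.some.injEq] at h
    simp [treeWord, wordPerm, ← h]
  | node _ l r ihl ihr =>
    simp only [treeWord, wordPerm, wordPerm_append, Vertex.perm, Equiv.Perm.mul_apply]
    rw [leafPaths, List.getElem?_append] at h
    rw [List.length_map, length_leafPaths] at h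
    split_ifs at h with hi
    · rw [List.getElem?_map, Option.map_eq_some_iff] at h
      obtain ⟨a, h, rfl⟩ := h
      rw [Stream'.cons_append_stream, splitPerm_cons]
      simp only [Bool.toNat_false, Nat.add_zero]
      rw [ihl h, treePerm_lt _ (by omega)]
    · rw [List.getElem?_map, Option.map_eq_some_iff] at h
      obtain ⟨a, h, rfl⟩ := h
      have := l.numLeaves_pos
      rw [Stream'.cons_append_stream, splitPerm_cons, Bool.toNat_true,
        treePerm_gt l (Nat.lt_succ_self o), show o + 1 + l.numLeaves - 1 = o + l.numLeaves by omega, ihr h]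
      congr 1
      omega

theorem pairPerm_leaf {s t : PTree} {i : ℕ} {a b : List Bool} (ha : (leafPaths s)[i]? = some a)
    (hb : (leafPaths t)[i]? = some b) (ξ : Stream' Bool) :
    wordPerm (pairWord s t) (0, a ++ₛ ξ) = (0, b ++ₛ ξ) := by
  rw [pairWord, wordPerm_append, wordPerm_star, Equiv.Perm.mul_apply, Equiv.Perm.inv_eq_iff_eq,
    treePerm_leaf ha, treePerm_leaf hb]

theorem pairPerm_gt {s t : PTree} (h : s.numLeaves = t.numLeaves) {j : ℕ} (hj : 0 < j)
    (ξ : Stream' Bool) : wordPerm (pairWord s t) (j, ξ) = (j, ξ) := by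
  rw [pairWord, wordPerm_append, wordPerm_star, Equiv.Perm.mul_apply, Equiv.Perm.inv_eq_iff_eq,
    treePerm_gt _ hj, treePerm_gt _ hj, h]

/-! ### Binary expansions -/

/-- The number in `[0, 1]` with the given binary expansion. -/
noncomputable def binaryValue (ξ : Stream' Bool) : ℝ :=
  Real.ofDigits (b := 2) fun n => if ξ n then 1 else 0

/-- The number with the given finite binary expansion. -/
noncomputable def finiteValue : List Bool → ℝ
  | [] => 0
  | b :: a => ((if b then 1 else 0) + finiteValue a) / 2

theorem binaryValue_mem (ξ : Stream' Bool) : binaryValue ξ ∈ Set.Icc (0 : ℝ) 1 :=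
  ⟨Real.ofDigits_nonneg _, Real.ofDigits_le_one _⟩

theorem exists_binaryValue_eq (x : unitInterval) : ∃ ξ, binaryValue ξ = x := by
  obtain ⟨d, -, hd⟩ := Real.ofDigits_SurjOn (b := 2) (by norm_num) x.2
  refine ⟨fun n => decide (d n = 1), ?_⟩
  rw [← hd]
  unfold binaryValue
  congr 1
  funext n
  have h : ∀ e : Fin 2, (if decide (e = 1) = true then 1 else 0) = e := by decide
  exact h (d n)

theorem binaryValue_cons (b : Bool) (ξ : Stream' Bool) :
    binaryValue (.cons b ξ) = ((if b then 1 else 0) + binaryValue ξ) / 2 := by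
  rw [binaryValue, Real.ofDigits_eq_sum_add_ofDigits _ 1]
  have h : (fun i => (if (Stream'.cons b ξ) (i + 1) then 1 else 0 : Fin 2)) =
      fun i => if ξ i then 1 else 0 := rfl
  rw [h]
  have h0 : (Stream'.cons b ξ) 0 = b := rfl
  simp only [Finset.range_one, Finset.sum_singleton, Real.ofDigitsTerm, h0, binaryValue]
  cases b <;> simp <;> ring

theorem binaryValue_append (a : List Bool) (ξ : Stream' Bool) :
    binaryValue (a ++ₛ ξ) = finiteValue a + binaryValue ξ / 2 ^ a.length := by
  induction a with
  | nil => simp [finiteValue]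
  | cons b a ih =>
    rw [Stream'.cons_append_stream, binaryValue_cons, ih, finiteValue, List.length_cons, pow_succ]
    field_simp
    ring

theorem leafIntervals_eq (t : PTree) (x l : ℝ) :
    leafIntervals t x l = (leafPaths t).map
      fun a => (x + l * finiteValue a, l / 2 ^ a.length) := by
  induction t generalizing x l with
  | nil => simp [leafIntervals, leafPaths, finiteValue]
  | node _ s t ihs iht =>
    rw [leafIntervals, leafPaths, List.map_append, List.map_map, List.map_map, ihs, iht]
    congr 2 <;> funext a <;>
      simp only [Function.comp, finiteValue, List.length_cons, pow_succ, Bool.false_eq_true,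
        if_true, if_false] <;> congr 1 <;> field_simp <;> ring

theorem Represents.forall₂ {s t : PTree} {g : unitInterval ≃o unitInterval}
    (h : Represents s t g) : List.Forall₂ (fun a b => ∀ ξ,
      (g ⟨binaryValue (a ++ₛ ξ), binaryValue_mem _⟩ : ℝ) = binaryValue (b ++ₛ ξ))
      (leafPaths s) (leafPaths t) := by
  rw [Represents, leafIntervals_eq, leafIntervals_eq, List.forall₂_map_left_iff,
    List.forall₂_map_right_iff] at h
  refine h.imp fun a b h ξ => ?_
  have hξ := binaryValue_mem ξ
  have ha : (0 : ℝ) < 2 ^ a.length := by positivity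
  have hb : (0 : ℝ) < 2 ^ b.length := by positivity
  rw [h]
  · simp only [binaryValue_append]
    field_simp
    ring
  · simp only [binaryValue_append]
    refine ⟨?_, ?_⟩
    · simp only [zero_add, one_mul, le_add_iff_nonneg_right]
      exact div_nonneg hξ.1 ha.le
    · simp only [zero_add, one_mul, add_le_add_iff_left]
      gcongr
      exact hξ.2

theorem Represents.numLeaves_eq {s t : PTree} {g : unitInterval ≃o unitInterval}
    (h : Represents s t g) : s.numLeaves = t.numLeaves := by
  rw [← length_leafPaths, ← length_leafPaths]
  exact h.forall₂.length_eq

/-- Both `g` and the diagram of its pair of trees replace the path of a leaf of the first tree by that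
of the corresponding leaf of the second one. -/
theorem Represents.exists_leaf {s t : PTree} {g : unitInterval ≃o unitInterval}
    (h : Represents s t g) (ξ : Stream' Bool) : ∃ a ∈ leafPaths s, ∃ b ∈ leafPaths t,
      (∃ η, ξ = a ++ₛ η) ∧ (∀ η, wordPerm (pairWord s t) (0, a ++ₛ η) = (0, b ++ₛ η)) ∧
      ∀ η, (g ⟨binaryValue (a ++ₛ η), binaryValue_mem _⟩ : ℝ) = binaryValue (b ++ₛ η) := by
  obtain ⟨a, ha, hξ⟩ := exists_leafPath s ξ
  obtain ⟨i, hi, rfl⟩ := List.getElem_of_mem ha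
  have hi' : i < (leafPaths t).length := h.forall₂.length_eq ▸ hi
  exact ⟨_, ha, (leafPaths t)[i], List.getElem_mem _, hξ,
    pairPerm_leaf (List.getElem?_eq_getElem hi) (List.getElem?_eq_getElem hi'),
    h.forall₂.get hi hi'⟩

theorem Represents.apply_binaryValue {s t : PTree} {g : unitInterval ≃o unitInterval}
    (h : Represents s t g) (ξ : Stream' Bool) : (g ⟨binaryValue ξ, binaryValue_mem ξ⟩ : ℝ) =
      binaryValue (wordPerm (pairWord s t) (0, ξ)).2 := by
  obtain ⟨a, -, b, -, ⟨η, rfl⟩, h1, h2⟩ := h.exists_leaf ξ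
  rw [h1, h2]

theorem eq_of_pairPerm_eq {s t s' t' : PTree} {g g' : unitInterval ≃o unitInterval}
    (h : Represents s t g) (h' : Represents s' t' g')
    (e : wordPerm (pairWord s t) = wordPerm (pairWord s' t')) : g = g' := by
  ext x
  obtain ⟨ξ, hξ⟩ := exists_binaryValue_eq x
  obtain rfl : ⟨binaryValue ξ, binaryValue_mem ξ⟩ = x := Subtype.ext hξ
  rw [h.apply_binaryValue, h'.apply_binaryValue, e]

/-! ### The action of the conjugate by the symmetric tree -/

theorem mem_leafPaths_symTree {k : ℕ} {a : List Bool} :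
    a ∈ leafPaths (symTree k) ↔ a.length = k := by
  induction k generalizing a with
  | zero => simp [symTree, leafPaths]
  | succ k ih =>
    simp only [symTree, leafPaths, List.mem_append, List.mem_map, ih]
    cases a with
    | nil => simp
    | cons b a => cases b <;> simp

theorem exists_symPerm {k : ℕ} {a : List Bool} (h : a.length = k) :
    ∃ j, ∀ ξ, wordPerm (treeWord (symTree k) 0) (0, a ++ₛ ξ) = (j, ξ) := by
  obtain ⟨i, hi, rfl⟩ := List.getElem_of_mem (mem_leafPaths_symTree.2 h)
  exact ⟨0 + i, treePerm_leaf (List.getElem?_eq_getElem hi) 0⟩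

/-- A strand below the symmetric tree is a leaf of this tree or lies on the right of it. -/
theorem exists_symPerm_inv (k j : ℕ) :
    (∃ a : List Bool, a.length = k ∧
      ∀ ξ, wordPerm (treeWord (symTree k) 0) (0, a ++ₛ ξ) = (j, ξ)) ∨
    ∃ m > 0, ∀ ξ, wordPerm (treeWord (symTree k) 0) (m, ξ) = (j, ξ) := by
  rcases lt_or_ge j (leafPaths (symTree k)).length with h | h
  · refine .inl ⟨(leafPaths (symTree k))[j], mem_leafPaths_symTree.1 (List.getElem_mem _), ?_⟩
    simpa using treePerm_leaf (List.getElem?_eq_getElem h) 0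
  · rw [length_leafPaths] at h
    have := (symTree k).numLeaves_pos
    refine .inr ⟨j + 1 - (symTree k).numLeaves, by omega, fun ξ => ?_⟩
    rw [treePerm_gt _ (by omega)]
    congr 1
    omega

/-- Here the bound on the heights is used: the path `c` of length `k` to a strand extends a path `a` to
a leaf of `s`, and it is carried to a path `b ++ r`, where `b` leads to a leaf of `t`. If `b ++ r`
has length at least `k`, then the strand is carried into a single strand, and otherwise its image
contains whole strands. -/
theorem isNice_conj_pairPerm {s t : PTree} {g : unitInterval ≃o unitInterval} {k : ℕ}
    (h : Represents s t g) (hs : s.height ≤ k) (ht : t.height ≤ k) :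
    IsNice (wordPerm (treeWord (symTree k) 0) * wordPerm (pairWord s t) *
      (wordPerm (treeWord (symTree k) 0))⁻¹) := by
  intro j ξ
  simp only [Equiv.Perm.mul_apply]
  have inv {m : ℕ} {η ζ : Stream' Bool}
      (e : wordPerm (treeWord (symTree k) 0) (m, η) = (j, ζ)) :
      (wordPerm (treeWord (symTree k) 0))⁻¹ (j, ζ) = (m, η) := by
    rw [Equiv.Perm.inv_eq_iff_eq, e]
  rcases exists_symPerm_inv k j with ⟨c, hc, hj⟩ | ⟨m, hm, hj⟩
  · obtain ⟨a, ha, b, hb, ⟨η, hη⟩, hp, -⟩ := h.exists_leaf (c ++ₛ ξ)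
    have ha' := (length_le_height ha).trans hs
    have hb' := (length_le_height hb).trans ht
    obtain ⟨r, rfl⟩ : ∃ r, c = a ++ r := by
      have := congrArg (Stream'.take a.length) hη
      rw [Stream'.take_append_of_le_length _ c _ (by omega),
        Stream'.take_append_of_le_length _ a _ le_rfl, List.take_length] at this
      exact ⟨c.drop a.length, by rw [← this, List.length_take, min_eq_left (by omega),
        List.take_append_drop]⟩
    have hq (ζ) : wordPerm (pairWord s t) (0, (a ++ r) ++ₛ ζ) = (0, (b ++ r) ++ₛ ζ) := by
      rw [Stream'.append_append_stream, hp, Stream'.append_append_stream]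
    rcases le_total k (b ++ r).length with hk | hk
    · left
      obtain ⟨i, hi⟩ := exists_symPerm (k := k) (a := (b ++ r).take k) (by simpa using hk)
      have hd' (η) : wordPerm (treeWord (symTree k) 0) (0, (b ++ r) ++ₛ η) =
          (i, (b ++ r).drop k ++ₛ η) := by
        rw [← hi, ← Stream'.append_append_stream, List.take_append_drop]
      refine ⟨(b ++ r).drop k, fun η => ?_⟩
      rw [inv (hj η), inv (hj ξ), hq, hq, hd', hd']
    · right
      set d := ξ.take (k - (b ++ r).length) with hd
      obtain ⟨i, hi⟩ := exists_symPerm (a := (b ++ r) ++ d) (k := k) (by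
        simp only [List.length_append, hd, Stream'.length_take] at hk ⊢
        omega)
      have hd' (η) : wordPerm (treeWord (symTree k) 0) (0, (b ++ r) ++ₛ (d ++ₛ η)) = (i, η) := by
        rw [← hi, ← Stream'.append_append_stream]
      refine ⟨d, fun η => ?_⟩
      rw [inv (hj (d ++ₛ η)), inv (hj ξ), hq, hq, hd']
      conv_rhs => rw [← Stream'.append_take_drop (k - (b ++ r).length) ξ, ← hd, hd']
  · left
    refine ⟨[], fun η => ?_⟩
    rw [inv (hj η), inv (hj ξ), pairPerm_gt h.numLeaves_eq hm, pairPerm_gt h.numLeaves_eq hm, hj, hj]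
    rfl

theorem wordPerm_theta (k : ℕ) (g : orientedF) : wordPerm (theta k g).word =
    wordPerm (treeWord (symTree k) 0) * wordPerm (pairWord (treePair g).1 (treePair g).2) *
      (wordPerm (treeWord (symTree k) 0))⁻¹ := by
  rw [theta, OSD.perm_reduce]
  simp only [OSD.stack, OSD.star, symDiagram, theta₀, wordPerm_append, wordPerm_star, mul_assoc]

theorem theta_perm_injective {k : ℕ} {g h : orientedF}
    (e : wordPerm (theta k g).word = wordPerm (theta k h).word) : g = h := by
  rw [wordPerm_theta, wordPerm_theta, mul_left_inj, mul_right_inj] at e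
  exact Subtype.ext (eq_of_pairPerm_eq (treePair_spec g).1.1 (treePair_spec h).1.1 e)

/-- If `k` is at least the height of `g`, then the merges of `theta k g` can be moved above
its splits. -/
theorem exists_wordIso_theta {k : ℕ} {g : orientedF} (hk : height g ≤ k) :
    ∃ M P : List ℕ, WordIso (theta k g).word (merges M ++ starWord (merges P)) := by
  refine OSD.IsReduced.exists_wordIso_merges_splits (D := theta k g) (OSD.reduce_spec _).2 ?_
  rw [wordPerm_theta]
  exact isNice_conj_pairPerm (treePair_spec g).1.1 ((le_max_left _ _).trans hk)
    ((le_max_right _ _).trans hk)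

/-! ### Labelings of a layer -/

theorem mem_segment_point {p P Q : Point} : p ∈ segment ℝ P Q ↔ ∃ t : ℝ, 0 ≤ t ∧ t ≤ 1 ∧
    p.1 = (1 - t) * P.1 + t * Q.1 ∧ p.2.1 = (1 - t) * P.2.1 + t * Q.2.1 ∧
      p.2.2 = (1 - t) * P.2.2 + t * Q.2.2 := by
  rw [segment_eq_image]
  constructor
  · rintro ⟨t, ht, rfl⟩
    exact ⟨t, ht.1, ht.2, by simp, by simp, by simp⟩
  · rintro ⟨t, h0, h1, h2, h3, h4⟩
    exact ⟨t, ⟨h0, h1⟩, by ext <;> simp [h2, h3, h4]⟩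

theorem isClosed_segment_point (P Q : Point) : IsClosed (segment ℝ P Q) := by
  rw [segment_eq_image]
  refine (isCompact_Icc.image ?_).isClosed
  fun_prop

/-- Disjoint closed sets can be labeled in any way. -/
theorem exists_labeling {ι : Type*} [Finite ι] (S : ι → Set Point) (hS : ∀ i, IsClosed (S i))
    (c : ι → Bool) (h : ∀ i j, i ≠ j → Disjoint (S i) (S j)) :
    ∃ F : Point → Bool, ContinuousOn F (⋃ i, S i) ∧ ∀ i, ∀ p ∈ S i, F p = c i := by
  classical
  have hF : ∀ i, ∀ p ∈ S i, decide (∃ j, c j = true ∧ p ∈ S j) = c i := by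
    intro i p hp
    rw [Bool.eq_iff_iff, decide_eq_true_iff]
    refine ⟨fun ⟨j, hj, hp'⟩ => ?_, fun hi => ⟨i, hi, hp⟩⟩
    by_cases e : i = j
    · rwa [e]
    · exact ((h i j e).le_bot ⟨hp, hp'⟩).elim
  refine ⟨fun p => decide (∃ j, c j = true ∧ p ∈ S j), ?_, hF⟩
  refine LocallyFinite.continuousOn_iUnion (locallyFinite_of_finite S) hS fun i => ?_
  exact continuousOn_const.congr (hF i)

/-- The strand number `k` between the heights `z` and `z'`, which ends in position `s k`. -/
def strand (s : ℕ → ℕ) (z z' : ℝ) (k : ℕ) : Set Point :=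
  segment ℝ ((k : ℝ), 0, z) ((s k : ℝ), 0, z')

/-- The arc which joins the two branches of a split. Its ends are at the height `z'`. -/
def arc (y z z' : ℝ) (i : ℕ) : Set Point :=
  segment ℝ (2 * (i : ℝ) + 1, 0, z') (2 * (i : ℝ) + 2, y, (z + z') / 2) ∪
    segment ℝ (2 * (i : ℝ) + 2, y, (z + z') / 2) (2 * (i : ℝ) + 3, 0, z')

/-- The position below a split of the strand `i` of the tangle strand which is in position `k`
above it. -/
def splitShift (i k : ℕ) : ℕ :=
  if k ≤ 2 * i then k else if k = 2 * i + 1 then k + 1 else k + 2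

theorem splitShift_strictMono (i : ℕ) : StrictMono (splitShift i) := by
  intro k l h
  simp only [splitShift]
  grind

theorem splitShift_cases {n i k : ℕ} (hi : i < n) (hk : k < 2 * (n + 1)) :
    (∃ l < 2 * n, k = splitShift i l ∧ ∀ x α, insertArc i x α k = α l) ∨
      (k = 2 * i + 1 ∧ ∀ x α, insertArc i x α k = x) ∨
      (k = 2 * i + 3 ∧ ∀ x α, insertArc i x α k = x) := by
  simp only [splitShift, insertArc]
  rcases lt_or_ge (2 * i) k with h | h
  · rcases (show k = 2 * i + 1 ∨ k = 2 * i + 2 ∨ k = 2 * i + 3 ∨ 2 * i + 4 ≤ k by omega)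
      with h1 | h1 | h1 | h1
    · exact .inr (.inl ⟨h1, by grind⟩)
    · exact .inl ⟨2 * i + 1, by omega, by grind, by grind⟩
    · exact .inr (.inr ⟨h1, by grind⟩)
    · exact .inl ⟨k - 2, by omega, by grind, by grind⟩
  · exact .inl ⟨k, by omega, by grind, by grind⟩

theorem left_mem_strand (s : ℕ → ℕ) (z z' : ℝ) (k : ℕ) : ((k : ℝ), 0, z) ∈ strand s z z' k :=
  left_mem_segment ..

theorem right_mem_strand (s : ℕ → ℕ) (z z' : ℝ) (k : ℕ) : ((s k : ℝ), 0, z') ∈ strand s z z' k :=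
  right_mem_segment ..

theorem left_mem_arc (y z z' : ℝ) (i : ℕ) : (2 * (i : ℝ) + 1, 0, z') ∈ arc y z z' i :=
  .inl (left_mem_segment ..)

theorem right_mem_arc (y z z' : ℝ) (i : ℕ) : (2 * (i : ℝ) + 3, 0, z') ∈ arc y z z' i :=
  .inr (right_mem_segment ..)

theorem isPreconnected_strand (s : ℕ → ℕ) (z z' : ℝ) (k : ℕ) :
    IsPreconnected (strand s z z' k) := (convex_segment ..).isPreconnected

theorem isPreconnected_arc (y z z' : ℝ) (i : ℕ) : IsPreconnected (arc y z z' i) :=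
  (convex_segment ..).isPreconnected.union _ (right_mem_segment ..) (left_mem_segment ..)
    (convex_segment ..).isPreconnected

theorem isClosed_strand (s : ℕ → ℕ) (z z' : ℝ) (k : ℕ) : IsClosed (strand s z z' k) :=
  isClosed_segment_point ..

theorem isClosed_arc (y z z' : ℝ) (i : ℕ) : IsClosed (arc y z z' i) :=
  (isClosed_segment_point ..).union (isClosed_segment_point ..)

theorem mem_strand {s : ℕ → ℕ} {z z' : ℝ} {k : ℕ} {p : Point} :
    p ∈ strand s z z' k ↔ ∃ t : ℝ, 0 ≤ t ∧ t ≤ 1 ∧ p.1 = (1 - t) * k + t * s k ∧ p.2.1 = 0 ∧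
      p.2.2 = (1 - t) * z + t * z' := by
  rw [strand, mem_segment_point]
  simp

/-- The only points of an arc in the plane of the strands are its two ends. -/
theorem eq_of_mem_arc {y z z' : ℝ} {i : ℕ} {p : Point} (hy : y ≠ 0) (hp : p ∈ arc y z z' i)
    (h : p.2.1 = 0) : p = (2 * (i : ℝ) + 1, 0, z') ∨ p = (2 * (i : ℝ) + 3, 0, z') := by
  obtain ⟨x, y', w⟩ := p
  rcases hp with hp | hp <;> rw [mem_segment_point] at hp <;>
    obtain ⟨t, -, -, h1, h2, h3⟩ := hp <;> simp only at h h1 h2 h3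
  · obtain rfl : t = 0 := by
      have : t * y = 0 := by linarith
      exact (mul_eq_zero.1 this).resolve_right hy
    left
    ext <;> simp_all
  · obtain rfl : t = 1 := by
      have : (1 - t) * y = 0 := by linarith
      linarith [(mul_eq_zero.1 this).resolve_right hy]
    right
    ext <;> simp_all

/-- An arc stays at positive distance from the side of the layer opposite to its ends, and it
reaches the other side in the plane of the strands only. -/
theorem arc_height {y z z' : ℝ} {i : ℕ} {p : Point} (hp : p ∈ arc y z z' i) :
    ∃ t : ℝ, 0 ≤ t ∧ t ≤ 1 ∧ p.2.2 = (1 - t) * z + t * z' ∧ (t < 1 ∨ p.2.1 = 0) ∧ 0 < t := by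
  rcases hp with hp | hp <;> rw [mem_segment_point] at hp <;>
    obtain ⟨t, h0, h1, -, h2, h3⟩ := hp <;> simp only at h2 h3
  · refine ⟨1 - t / 2, by linarith, by linarith, by rw [h3]; ring, ?_, by linarith⟩
    rcases h0.eq_or_lt with rfl | h
    · right; simp [h2]
    · left; linarith
  · refine ⟨1 - (1 - t) / 2, by linarith, by linarith, by rw [h3]; ring, ?_, by linarith⟩
    rcases h1.eq_or_lt with rfl | h
    · right; simp [h2]
    · left; linarith

theorem disjoint_strand {s : ℕ → ℕ} (hs : StrictMono s) {z z' : ℝ} (hz : z ≠ z') {k l : ℕ}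
    (h : k ≠ l) : Disjoint (strand s z z' k) (strand s z z' l) := by
  wlog hkl : k < l generalizing k l
  · exact (this h.symm (by omega)).symm
  rw [Set.disjoint_left]
  intro p hp hp'
  obtain ⟨t, h0, h1, h2, -, h3⟩ := mem_strand.1 hp
  obtain ⟨t', -, -, h2', -, h3'⟩ := mem_strand.1 hp'
  obtain rfl : t = t' := by
    have : (t - t') * (z' - z) = 0 := by linarith
    rcases mul_eq_zero.1 this with h | h
    · linarith
    · exact absurd (by linarith) hz
  have e1 : (k : ℝ) + 1 ≤ l := by exact_mod_cast hkl
  have e2 : (s k : ℝ) + 1 ≤ s l := by exact_mod_cast hs hkl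
  nlinarith

theorem disjoint_arc {i : ℕ} {y z z' : ℝ} (hy : y ≠ 0) (hz : z ≠ z') (k : ℕ) :
    Disjoint (strand (splitShift i) z z' k) (arc y z z' i) := by
  rw [Set.disjoint_left]
  intro p hp hp'
  obtain ⟨t, h0, h1, h2, h3, h4⟩ := mem_strand.1 hp
  have key (n : ℕ) (hn : p = ((n : ℝ), 0, z')) : splitShift i k = n := by
    subst hn
    simp only at h2 h4
    obtain rfl : t = 1 := by
      have : (1 - t) * (z' - z) = 0 := by linarith
      rcases mul_eq_zero.1 this with h | h
      · linarith
      · exact absurd (by linarith) hz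
    simp only [sub_self, zero_mul, one_mul, zero_add] at h2
    exact_mod_cast h2.symm
  rcases eq_of_mem_arc hy hp' h3 with e | e
  · have := key (2 * i + 1) (by rw [e]; push_cast; rfl)
    simp only [splitShift] at this
    grind
  · have := key (2 * i + 3) (by rw [e]; push_cast; rfl)
    simp only [splitShift] at this
    grind

/-- The points of the tangle near a split, with `n` strands above it. With `z < z'` these are the
points near a merge with `n` strands below it. -/
def splitLayer (y z z' : ℝ) (n i : ℕ) : Set Point :=
  (⋃ k : Fin (2 * n), strand (splitShift i) z z' k) ∪ arc y z z' i

/-- The points of `n` doubled straight strands. -/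
def straightLayer (z z' : ℝ) (n : ℕ) : Set Point := ⋃ k : Fin (2 * n), strand id z z' k

theorem exists_labeling_straightLayer {z z' : ℝ} (hz : z ≠ z') (n : ℕ) (α : ℕ → Bool) :
    ∃ F : Point → Bool, ContinuousOn F (straightLayer z z' n) ∧
      (∀ k < 2 * n, F (k, 0, z) = α k) ∧ ∀ k < 2 * n, F (k, 0, z') = α k := by
  obtain ⟨F, hF, h⟩ := exists_labeling (fun k : Fin (2 * n) => strand id z z' k)
    (fun k => isClosed_strand ..) (fun k => α k)
    fun k l hkl => disjoint_strand strictMono_id hz fun e => hkl (Fin.ext e)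
  exact ⟨F, hF, fun k hk => h ⟨k, hk⟩ _ (left_mem_strand ..),
    fun k hk => h ⟨k, hk⟩ _ (right_mem_strand ..)⟩

theorem exists_labeling_splitLayer {y z z' : ℝ} (hy : y ≠ 0) (hz : z ≠ z') {n i : ℕ}
    (hi : i < n) (x : Bool) (α : ℕ → Bool) :
    ∃ F : Point → Bool, ContinuousOn F (splitLayer y z z' n i) ∧
      (∀ k < 2 * n, F (k, 0, z) = α k) ∧
        ∀ k < 2 * (n + 1), F (k, 0, z') = insertArc i x α k := by
  obtain ⟨F, hF, h⟩ := exists_labeling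
    (fun o : Option (Fin (2 * n)) => o.elim (arc y z z' i) fun k => strand (splitShift i) z z' k)
    (by rintro (_ | k); exacts [isClosed_arc .., isClosed_strand ..])
    (fun o => o.elim x fun k => α k) (by
      rintro (_ | k) (_ | l) hkl
      · exact absurd rfl hkl
      · exact (disjoint_arc hy hz _).symm
      · exact disjoint_arc hy hz _
      · exact disjoint_strand (splitShift_strictMono i) hz fun e => hkl (by rw [Fin.ext e]))
  have hs (k : ℕ) (hk : k < 2 * n) : F (splitShift i k, 0, z') = α k :=
    h (some ⟨k, hk⟩) _ (right_mem_strand ..)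
  have h1 : F (2 * (i : ℝ) + 1, 0, z') = x := h none _ (left_mem_arc ..)
  have h3 : F (2 * (i : ℝ) + 3, 0, z') = x := h none _ (right_mem_arc ..)
  refine ⟨F, ?_, fun k hk => h (some ⟨k, hk⟩) _ (left_mem_strand ..), fun k hk => ?_⟩
  · rwa [Set.iUnion_option, Set.union_comm] at hF
  · rcases splitShift_cases hi hk with ⟨l, hl, rfl, e⟩ | ⟨rfl, e⟩ | ⟨rfl, e⟩
    · rw [hs l hl, e]
    · rw [e, ← h1]
      push_cast
      rfl
    · rw [e, ← h3]
      push_cast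
      rfl


/-- The labels of the points on the line at height `z` which meets `n` strands, continued
by `τ`. -/
def lineLabel (n : ℕ) (z : ℝ) (F : Point → Bool) (τ : ℕ → Bool) (k : ℕ) : Bool :=
  if k < 2 * n then F (k, 0, z) else τ (k - 2 * n)

theorem lineLabel_straightLayer {z z' : ℝ} {n : ℕ} {F : Point → Bool}
    (hF : ContinuousOn F (straightLayer z z' n)) (τ : ℕ → Bool) :
    lineLabel n z F τ = lineLabel n z' F τ := by
  funext k
  simp only [lineLabel]
  split_ifs with hk
  · exact (isPreconnected_strand id z z' k).constant
      (hF.mono (Set.subset_iUnion (fun k : Fin (2 * n) => strand id z z' k) ⟨k, hk⟩))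
      (left_mem_strand ..) (right_mem_strand ..)
  · rfl

theorem lineLabel_splitLayer {y z z' : ℝ} {n i : ℕ} (hi : i < n) {F : Point → Bool}
    (hF : ContinuousOn F (splitLayer y z z' n i)) (τ : ℕ → Bool) :
    ∃ x, lineLabel (n + 1) z' F τ = insertArc i x (lineLabel n z F τ) := by
  have h : F (2 * (i : ℝ) + 1, 0, z') = F (2 * (i : ℝ) + 3, 0, z') :=
    (isPreconnected_arc y z z' i).constant (hF.mono Set.subset_union_right)
      (left_mem_arc ..) (right_mem_arc ..)
  have hs (k : ℕ) (hk : k < 2 * n) : F (k, 0, z) = F (splitShift i k, 0, z') :=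
    (isPreconnected_strand _ z z' k).constant
      (hF.mono ((Set.subset_iUnion (fun k : Fin (2 * n) => strand (splitShift i) z z' k)
        ⟨k, hk⟩).trans Set.subset_union_left)) (left_mem_strand ..) (right_mem_strand ..)
  refine ⟨F (2 * (i : ℝ) + 1, 0, z'), ?_⟩
  funext k
  by_cases hk : k < 2 * (n + 1)
  · rw [lineLabel, if_pos hk]
    rcases splitShift_cases hi hk with ⟨l, hl, rfl, e⟩ | ⟨rfl, e⟩ | ⟨rfl, e⟩
    · rw [e, lineLabel, if_pos hl, hs l hl]
    · rw [e]
      push_cast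
      rfl
    · rw [e, h]
      push_cast
      rfl
  · rw [lineLabel, if_neg hk]
    simp only [insertArc, lineLabel]
    grind

/-! ### Labelings of the tangle of a word -/

theorem seg_orient (s : Bool) (P Q : Point) : seg (orient s P Q) = segment ℝ P Q := by
  cases s
  · simp [seg, orient, segment_symm]
  · simp [seg, orient]

theorem carrier_append (S T : PLTangle) :
    PLTangle.carrier (S ++ T) = PLTangle.carrier S ∪ PLTangle.carrier T := by
  ext x
  simp [PLTangle.carrier, or_and_right, exists_or]

theorem carrier_map_swap (T : PLTangle) :
    PLTangle.carrier (T.map Prod.swap) = PLTangle.carrier T := by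
  ext x
  simp only [PLTangle.carrier, List.mem_map, Set.mem_ofPred_eq]
  constructor
  · rintro ⟨_, ⟨e, he, rfl⟩, hx⟩
    exact ⟨e, he, by rwa [seg, segment_symm] at hx⟩
  · rintro ⟨e, he, hx⟩
    exact ⟨_, ⟨e, he, rfl⟩, by rwa [seg, segment_symm]⟩

theorem isClosed_carrier (T : PLTangle) : IsClosed T.carrier := by
  have : T.carrier = ⋃ e ∈ {e | e ∈ T}, seg e := by
    ext x
    simp [PLTangle.carrier]
  rw [this]
  exact (List.finite_toSet T).isClosed_biUnion fun e _ => isClosed_segment_point ..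

theorem length_double (μ : List Bool) : (double μ).length = 2 * μ.length := by
  induction μ with
  | nil => rfl
  | cons s μ ih =>
    have : double (s :: μ) = s :: (!s) :: double μ := rfl
    simp [this, ih, mul_add]

theorem carrier_strands (μ : List Bool) (P Q : ℕ → Point) :
    PLTangle.carrier ((double μ).zipIdx.map fun p => orient p.1 (P p.2) (Q p.2)) =
      ⋃ k : Fin (2 * μ.length), segment ℝ (P k) (Q k) := by
  ext x
  simp only [PLTangle.carrier, List.mem_map, Set.mem_ofPred_eq, Set.mem_iUnion]
  constructor
  · rintro ⟨_, ⟨⟨s, k⟩, hk, rfl⟩, hx⟩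
    rw [List.mem_zipIdx_iff_getElem?] at hk
    have := (List.getElem?_eq_some_iff.1 hk).1
    rw [length_double] at this
    exact ⟨⟨k, this⟩, by rwa [seg_orient] at hx⟩
  · rintro ⟨⟨k, hk⟩, hx⟩
    rw [← length_double] at hk
    exact ⟨_, ⟨((double μ)[k], k), List.mem_zipIdx_iff_getElem?.2 (List.getElem?_eq_getElem hk),
      rfl⟩, by rwa [seg_orient]⟩

theorem carrier_straightSegments (z z' : ℝ) (μ : List Bool) :
    PLTangle.carrier (straightSegments z z' μ) = straightLayer z z' μ.length :=
  carrier_strands μ (fun k => (k, 0, z)) fun k => (k, 0, z')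

theorem carrier_splitSegments (y z z' : ℝ) (μ : List Bool) (i : ℕ) :
    PLTangle.carrier (splitSegments y z z' μ i) = splitLayer y z z' μ.length i := by
  rw [splitSegments, carrier_append, splitLayer]
  congr 1
  · refine (carrier_strands μ (fun k => (k, 0, z)) fun k => ((if k ≤ 2 * i then (k : ℝ)
      else if k = 2 * i + 1 then (k : ℝ) + 1 else (k : ℝ) + 2), 0, z')).trans ?_
    refine Set.iUnion_congr fun k => ?_
    rw [strand, splitShift]
    push_cast
    rfl
  · ext x
    simp [PLTangle.carrier, seg_orient, arc]

theorem carrier_mergeSegments (y z z' : ℝ) (ν : List Bool) (i : ℕ) :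
    PLTangle.carrier (mergeSegments y z z' ν i) = splitLayer y z' z ν.length i := by
  rw [mergeSegments, carrier_map_swap, carrier_splitSegments]

theorem splitLayer_height {y z z' : ℝ} {n i : ℕ} {p : Point} (hp : p ∈ splitLayer y z z' n i) :
    ∃ t : ℝ, 0 ≤ t ∧ t ≤ 1 ∧ p.2.2 = (1 - t) * z + t * z' := by
  rcases hp with hp | hp
  · obtain ⟨k, hp⟩ := Set.mem_iUnion.1 hp
    obtain ⟨t, h0, h1, -, -, h⟩ := mem_strand.1 hp
    exact ⟨t, h0, h1, h⟩
  · obtain ⟨t, h0, h1, h, -⟩ := arc_height hp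
    exact ⟨t, h0, h1, h⟩

theorem splitLayer_top {y z z' : ℝ} (hz : z ≠ z') {n i : ℕ} {p : Point}
    (hp : p ∈ splitLayer y z z' n i) (h : p.2.2 = z) : ∃ k < 2 * n, p = ((k : ℝ), 0, z) := by
  have ht {t : ℝ} (e : p.2.2 = (1 - t) * z + t * z') : t = 0 := by
    have : t * (z' - z) = 0 := by linarith
    exact (mul_eq_zero.1 this).resolve_right (sub_ne_zero.2 hz.symm)
  rcases hp with hp | hp
  · obtain ⟨k, hp⟩ := Set.mem_iUnion.1 hp
    obtain ⟨t, -, -, h1, h2, h3⟩ := mem_strand.1 hp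
    obtain rfl := ht h3
    exact ⟨k, k.2, by ext <;> simp_all⟩
  · obtain ⟨t, -, -, h3, -, h4⟩ := arc_height hp
    exact absurd (ht h3) h4.ne'

theorem splitLayer_bottom {y z z' : ℝ} (hy : y ≠ 0) (hz : z ≠ z') {n i : ℕ} (hi : i < n)
    {p : Point} (hp : p ∈ splitLayer y z z' n i) (h : p.2.2 = z') :
    ∃ k < 2 * (n + 1), p = ((k : ℝ), 0, z') := by
  have ht {t : ℝ} (e : p.2.2 = (1 - t) * z + t * z') : t = 1 := by
    have : (1 - t) * (z' - z) = 0 := by linarith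
    linarith [(mul_eq_zero.1 this).resolve_right (sub_ne_zero.2 hz.symm)]
  rcases hp with hp | hp
  · obtain ⟨k, hp⟩ := Set.mem_iUnion.1 hp
    obtain ⟨t, -, -, h1, h2, h3⟩ := mem_strand.1 hp
    obtain rfl := ht h3
    refine ⟨splitShift i k, ?_, by ext <;> simp_all⟩
    have := k.2
    simp only [splitShift]
    grind
  · obtain ⟨t, -, -, h3, h4, -⟩ := arc_height hp
    rcases eq_of_mem_arc hy hp (h4.resolve_left (ht h3).not_lt) with e | e
    · exact ⟨2 * i + 1, by omega, by rw [e]; push_cast; rfl⟩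
    · exact ⟨2 * i + 3, by omega, by rw [e]; push_cast; rfl⟩

theorem length_splitSigns {i : ℕ} {μ ν : List Bool} (h : splitSigns i μ = some ν) :
    i < μ.length ∧ ν.length = μ.length + 1 := by
  induction i generalizing μ ν with
  | zero =>
    rcases μ with _ | ⟨s, μ⟩ <;> simp [splitSigns] at h
    simp [← h]
  | succ i ih =>
    rcases μ with _ | ⟨s, μ⟩ <;> simp [splitSigns] at h
    obtain ⟨ν, h, rfl⟩ := h
    simpa using ih h

/-- The part of the tangle in the layer of a vertex. -/
noncomputable def vertexSegments (y z z' : ℝ) (μ ν : List Bool) : Vertex → PLTangle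
  | .split i => splitSegments y z z' μ i
  | .merge i => mergeSegments y z z' ν i

theorem wordSegments_cons (y d z : ℝ) {μ ν : List Bool} {v : Vertex} (w : List Vertex)
    (h : v.signs μ = some ν) : wordSegments y d z μ (v :: w) =
      vertexSegments y z (z - d) μ ν v ++ wordSegments y d (z - d) ν w := by
  cases v with
  | split i =>
    rw [wordSegments, vertexSegments, show splitSigns i μ = some ν from h]
    rfl
  | merge i =>
    rw [wordSegments, vertexSegments, show mergeSigns i μ = some ν from h]
    rfl

theorem lineLabel_vertexSegments {y z z' : ℝ} {μ ν : List Bool} {v : Vertex}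
    (h : v.signs μ = some ν) {F : Point → Bool}
    (hF : ContinuousOn F (vertexSegments y z z' μ ν v).carrier) (τ : ℕ → Bool) :
    v.Rel (lineLabel μ.length z F τ) (lineLabel ν.length z' F τ) := by
  cases v with
  | split i =>
    obtain ⟨h1, h2⟩ := length_splitSigns h
    rw [vertexSegments, carrier_splitSegments] at hF
    rw [h2]
    exact lineLabel_splitLayer h1 hF τ
  | merge i =>
    obtain ⟨h1, h2⟩ := length_splitSigns ((splitSigns_iff _ _ _).2 h)
    rw [vertexSegments, carrier_mergeSegments] at hF
    rw [h2]
    exact lineLabel_splitLayer h1 hF τ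

theorem exists_labeling_vertexSegments {y z z' : ℝ} (hy : y ≠ 0) (hz : z ≠ z') {μ ν : List Bool}
    {v : Vertex} (h : v.signs μ = some ν) {α β : ℕ → Bool} (hv : v.Rel α β) :
    ∃ F : Point → Bool, ContinuousOn F (vertexSegments y z z' μ ν v).carrier ∧
      (∀ k < 2 * μ.length, F (k, 0, z) = α k) ∧ ∀ k < 2 * ν.length, F (k, 0, z') = β k := by
  cases v with
  | split i =>
    obtain ⟨h1, h2⟩ := length_splitSigns h
    obtain ⟨x, rfl⟩ := hv
    rw [vertexSegments, carrier_splitSegments, h2]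
    exact exists_labeling_splitLayer hy hz h1 x α
  | merge i =>
    obtain ⟨h1, h2⟩ := length_splitSigns ((splitSigns_iff _ _ _).2 h)
    obtain ⟨x, rfl⟩ := hv
    rw [vertexSegments, carrier_mergeSegments, h2]
    obtain ⟨F, hF, h3, h4⟩ := exists_labeling_splitLayer hy hz.symm h1 x β
    exact ⟨F, hF, h4, h3⟩

theorem vertexSegments_bottom {y z z' : ℝ} (hy : y ≠ 0) (hz : z ≠ z') {μ ν : List Bool}
    {v : Vertex} (h : v.signs μ = some ν) {p : Point}
    (hp : p ∈ (vertexSegments y z z' μ ν v).carrier) (h' : p.2.2 = z') :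
    ∃ k < 2 * ν.length, p = ((k : ℝ), 0, z') := by
  cases v with
  | split i =>
    obtain ⟨h1, h2⟩ := length_splitSigns h
    rw [vertexSegments, carrier_splitSegments] at hp
    rw [h2]
    exact splitLayer_bottom hy hz h1 hp h'
  | merge i =>
    rw [vertexSegments, carrier_mergeSegments] at hp
    exact splitLayer_top hz.symm hp h'

theorem vertexSegments_height {y z z' : ℝ} (hz : z' ≤ z) {μ ν : List Bool} {v : Vertex} {p : Point}
    (hp : p ∈ (vertexSegments y z z' μ ν v).carrier) : z' ≤ p.2.2 ∧ p.2.2 ≤ z := by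
  cases v with
  | split i =>
    rw [vertexSegments, carrier_splitSegments] at hp
    obtain ⟨t, h0, h1, h⟩ := splitLayer_height hp
    constructor <;> nlinarith
  | merge i =>
    rw [vertexSegments, carrier_mergeSegments] at hp
    obtain ⟨t, h0, h1, h⟩ := splitLayer_height hp
    constructor <;> nlinarith

theorem wordSegments_height {y d : ℝ} (hd : 0 < d) {z : ℝ} {μ ν : List Bool} {w : List Vertex}
    (h : transport μ w = some ν) {p : Point} (hp : p ∈ (wordSegments y d z μ w).carrier) :
    p.2.2 ≤ z := by
  induction w generalizing z μ with
  | nil =>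
    rw [wordSegments, carrier_straightSegments] at hp
    obtain ⟨k, hp⟩ := Set.mem_iUnion.1 hp
    obtain ⟨t, h0, h1, -, -, h⟩ := mem_strand.1 hp
    nlinarith
  | cons v w ih =>
    simp only [transport, Option.bind_eq_some_iff] at h
    obtain ⟨κ, h1, h2⟩ := h
    rw [wordSegments_cons y d z w h1, carrier_append] at hp
    rcases hp with hp | hp
    · exact (vertexSegments_height (by linarith) hp).2
    · linarith [ih h2 hp]

/-- A continuous labeling of the tangle gives compatible labels on the top and on
the bottom. -/
theorem wordRel_lineLabel {y d z : ℝ} {μ ν : List Bool} {w : List Vertex}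
    (h : transport μ w = some ν) {F : Point → Bool}
    (hF : ContinuousOn F (wordSegments y d z μ w).carrier) (τ : ℕ → Bool) :
    WordRel w (lineLabel μ.length z F τ)
      (lineLabel ν.length (z - (w.length + 1) * d) F τ) := by
  induction w generalizing z μ with
  | nil =>
    obtain rfl : μ = ν := Option.some_inj.1 h
    rw [wordSegments, carrier_straightSegments] at hF
    simpa [WordRel] using lineLabel_straightLayer hF τ
  | cons v w ih =>
    simp only [transport, Option.bind_eq_some_iff] at h
    obtain ⟨κ, h1, h2⟩ := h
    rw [wordSegments_cons y d z w h1, carrier_append] at hF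
    refine ⟨_, lineLabel_vertexSegments h1 (hF.mono Set.subset_union_left) τ, ?_⟩
    convert ih h2 (hF.mono Set.subset_union_right) using 2
    rw [List.length_cons]
    push_cast
    ring

/-- Compatible labels on the top and on the bottom extend to a continuous labeling of
the tangle. -/
theorem exists_labeling_wordSegments {y d z : ℝ} (hy : y ≠ 0) (hd : 0 < d) {μ ν : List Bool}
    {w : List Vertex} (h : transport μ w = some ν) {α β : ℕ → Bool} (hw : WordRel w α β) :
    ∃ F : Point → Bool, ContinuousOn F (wordSegments y d z μ w).carrier ∧
      (∀ k < 2 * μ.length, F (k, 0, z) = α k) ∧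
        ∀ k < 2 * ν.length, F (k, 0, z - (w.length + 1) * d) = β k := by
  induction w generalizing z μ α with
  | nil =>
    obtain rfl : μ = ν := Option.some_inj.1 h
    obtain rfl : α = β := hw
    rw [wordSegments, carrier_straightSegments]
    simpa using exists_labeling_straightLayer (show z ≠ z - d by linarith) μ.length α
  | cons v w ih =>
    simp only [transport, Option.bind_eq_some_iff] at h
    obtain ⟨κ, h1, h2⟩ := h
    obtain ⟨γ, hv, hw⟩ := hw
    have hz : z ≠ z - d := by linarith
    obtain ⟨G, hG, hα, hγ⟩ := exists_labeling_vertexSegments hy hz h1 hv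
    obtain ⟨H, hH, hγ', hβ⟩ := ih (z := z - d) h2 hw
    -- The first layer and the rest of the tangle meet in points of the line at height `z - d`, where
    -- both labelings are given by `γ`.
    refine ⟨fun p => if z - d < p.2.2 then G p else H p, ?_, fun k hk => ?_, fun k hk => ?_⟩
    · rw [wordSegments_cons y d z w h1, carrier_append]
      refine ContinuousOn.union_of_isClosed (hG.congr fun p hp => ?_) (hH.congr fun p hp => ?_)
        (isClosed_carrier _) (isClosed_carrier _)
      · rcases (vertexSegments_height (by linarith) hp).1.lt_or_eq with h3 | h3
        · simp [h3]
        · obtain ⟨k, hk, rfl⟩ := vertexSegments_bottom hy hz h1 hp h3.symm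
          simp [hγ k hk, hγ' k hk]
      · simp [(wordSegments_height hd h2 hp).not_gt]
    · simp [hd, hα k hk]
    · have e : z - ((v :: w).length + 1) * d = z - d - (w.length + 1) * d := by
        rw [List.length_cons]
        push_cast
        ring
      have : ¬ z - d < z - d - (w.length + 1) * d := by
        have : 0 ≤ ((w.length : ℝ) + 1) * d := by positivity
        linarith
      rw [e]
      simp only [this, if_false]
      exact hβ k hk

theorem rel_tail {μ ν : List Bool} {v : Vertex} (h : v.signs μ = some ν) {α β : ℕ → Bool}
    (hv : v.Rel α β) (k : ℕ) : β (2 * ν.length + k) = α (2 * μ.length + k) := by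
  cases v with
  | split i =>
    obtain ⟨h1, h2⟩ := length_splitSigns h
    obtain ⟨x, rfl⟩ := hv
    simp only [insertArc]
    grind
  | merge i =>
    obtain ⟨h1, h2⟩ := length_splitSigns ((splitSigns_iff _ _ _).2 h)
    obtain ⟨x, rfl⟩ := hv
    simp only [insertArc]
    grind

theorem wordRel_tail {μ ν : List Bool} {w : List Vertex} (h : transport μ w = some ν)
    {α β : ℕ → Bool} (hw : WordRel w α β) (k : ℕ) :
    β (2 * ν.length + k) = α (2 * μ.length + k) := by
  induction w generalizing μ α with
  | nil =>
    obtain rfl : μ = ν := Option.some_inj.1 h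
    obtain rfl : α = β := hw
    rfl
  | cons v w ih =>
    simp only [transport, Option.bind_eq_some_iff] at h
    obtain ⟨κ, h1, h2⟩ := h
    obtain ⟨γ, hv, hw⟩ := hw
    rw [ih h2 hw, rel_tail h1 hv]

/-- Compatible labels are transported by homeomorphisms which fix the top and the bottom. -/
theorem wordRel_of_homeomorph {front : Bool} {μ ν : List Bool} (D E : OSD μ ν)
    (ψ : Point → Point) (hψ : Continuous ψ) (hD : Set.MapsTo ψ (E.tangle front).carrier
      (D.tangle front).carrier) (h1 : ∀ x : ℝ, ψ (x, 0, 1) = (x, 0, 1))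
    (h0 : ∀ x : ℝ, ψ (x, 0, 0) = (x, 0, 0)) {α β : ℕ → Bool} (h : WordRel D.word α β) :
    WordRel E.word α β := by
  have hz (D : OSD μ ν) : 1 - ((D.word.length : ℝ) + 1) * (1 / ((D.word.length : ℝ) + 1)) = 0 := by
    have : (D.word.length : ℝ) + 1 ≠ 0 := by positivity
    field_simp
    ring
  obtain ⟨F, hF, hα, hβ⟩ := exists_labeling_wordSegments (z := 1)
    (y := if front then 1 else -1) (d := 1 / ((D.word.length : ℝ) + 1))
    (by cases front <;> norm_num) (by positivity) D.valid h
  -- On the right of the tangles the labels are not changed, as `D` and `E` have the same widths.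
  have := wordRel_lineLabel E.valid (hF.comp hψ.continuousOn hD)
    fun k => α (2 * μ.length + k)
  rw [hz] at this hβ
  convert this using 1
  · funext k
    simp only [lineLabel, Function.comp]
    split_ifs with hk
    · rw [h1, hα k hk]
    · congr 1
      omega
  · funext k
    simp only [lineLabel, Function.comp]
    split_ifs with hk
    · rw [h0, hβ k hk]
    · rw [← wordRel_tail D.valid h]
      congr 1
      omega

/-- The labels which are compatible with a diagram are an isotopy invariant of its tangle. -/
theorem wordRel_iff_of_isotopic {front : Bool} {μ ν : List Bool} {D E : OSD μ ν}
    (h : PLTangle.Isotopic (D.tangle front) (E.tangle front)) (α β : ℕ → Bool) :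
    WordRel D.word α β ↔ WordRel E.word α β := by
  obtain ⟨φ, -, -, hφ, hc, -⟩ := h
  have h1 (x : ℝ) : φ 1 (x, 0, 1) = (x, 0, 1) := hφ 1 _ (by simp)
  have h0 (x : ℝ) : φ 1 (x, 0, 0) = (x, 0, 0) := hφ 1 _ (by simp)
  constructor
  · refine wordRel_of_homeomorph (front := front) D E (φ 1).symm (φ 1).symm.continuous ?_ ?_ ?_
    · rw [← hc]
      rintro _ ⟨p, hp, rfl⟩
      rwa [Homeomorph.symm_apply_apply]
    · intro x
      rw [Homeomorph.symm_apply_eq, h1]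
    · intro x
      rw [Homeomorph.symm_apply_eq, h0]
  · refine wordRel_of_homeomorph (front := front) E D (φ 1) (φ 1).continuous ?_ h1 h0
    intro p hp
    rw [← hc]
    exact ⟨p, hp, rfl⟩

end OrientedThompson

theorem mainTheorem3 (front : Bool) (g h : OrientedThompson.orientedF) (hgh : g ≠ h) (k : ℕ)
    (hk : max (OrientedThompson.height g) (OrientedThompson.height h) ≤ k) :
    ¬ OrientedThompson.PLTangle.Isotopic
        ((OrientedThompson.theta k g).tangle front) ((OrientedThompson.theta k h).tangle front) := by
  intro hiso
  obtain ⟨M, P, hg⟩ := OrientedThompson.exists_wordIso_theta ((le_max_left _ _).trans hk)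
  obtain ⟨M', P', hh⟩ := OrientedThompson.exists_wordIso_theta ((le_max_right _ _).trans hk)
  exact hgh (OrientedThompson.theta_perm_injective
    (OrientedThompson.wordPerm_eq_of_wordRel_iff hg hh
      (OrientedThompson.wordRel_iff_of_isotopic hiso)))
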